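/- **Theorem 5.1.** Let $n\in\mathbb N$ and $z\in[0,1]^n$. Then $z$ is Schnorr random if and only if $z$ is a weak Lebesgue point of every bounded $L_1$-computable function $g\colon[0,1]^n\to\mathbb R$. Here $\lambda$ is Lebesgue measure and the following definitions are used. - A sequence $(G_m)_{m\in\mathbb N}$ of subsets of $[0,1]^n$ is *uniformly $\Sigma^0_1$* if $G_m=[0,1]^n\cap H_m$, where $H_m\subseteq\mathbb R^n$ is a union of open axis-parallel cubes with rational coordinates (possibly the empty union) that are enumerated effectively, uniformly in $m$. It is a *Schnorr test* if moreover $\lambda G_m\le 2^{-m}$ for all $m$ and $\lambda G_m$ is a computable real uniformly in $m$. The point $z$ is *Schnorr random* if $z\notin\bigcap_m G_m$ for each Schnorr test $(G_m)_{m\in\mathbb N}$. - A function $h\colon[0,1]^n\to\mathbb R$ is *computable* if $h(q)$ is a computable real uniformly in $q\in[0,1]^n\cap\mathbb Q^n$, and there is a computable $r\colon\mathbb N\to\mathbb N$ such that for all $k$ and all $x,y\in[0,1]^n$, $|x-y|<2^{-r(k)}$ implies $|h(x)-h(y)|<2^{-k}$. A function $g\colon[0,1]^n\to\mathbb R$ is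 *$L_1$-computable* if it is integrable and there is a uniformly computable sequence $(h_k)_{k\in\mathbb N}$ of computable functions on $[0,1]^n$ with $\int_{[0,1]^n}|g-h_k|\,d\lambda<2^{-k}$ for all $k$. - The point $z$ is a *weak Lebesgue point* of an integrable $g\colon[0,1]^n\to\mathbb R$ if the limit $$\lim_{z\in Q,\ \lambda Q\to0}\frac1{\lambda Q}\int_Q g\,d\lambda$$ exists in $\mathbb R$, where $Q$ ranges over the closed nondegenerate axis-parallel cubes contained in $[0,1]^n$. -/

import Mathlib

namespace Schnorr

open MeasureTheory Set

/-- The unit cube `[0,1]^n`; here `ℝ^n` is `Fin n → ℝ`, with Lebesgue measure `volume`. -/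
def unitCube (n : ℕ) : Set (Fin n → ℝ) := Icc 0 1

/-! ### Effective presentations

Computability on countable data is Mathlib's `Computable`. A rational number is presented by a
triple of natural numbers. -/

/-- Names of rational numbers. -/
abbrev RatCode : Type := ℕ × ℕ × ℕ

/-- The rational number `(a - b) / (c + 1)` named by `(a, b, c)`; every rational has a name. -/
def RatCode.val (p : RatCode) : ℚ := ((p.1 : ℚ) - (p.2.1 : ℚ)) / ((p.2.2 : ℚ) + 1)

/-- The rational point named by an `n`-tuple of names. -/
def ratPoint {n : ℕ} (p : Fin n → RatCode) : Fin n → ℝ := fun i => ((p i).val : ℝ)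

/-- The real `x a` is a computable real, uniformly in `a ∈ S`: from `a` and `k` one can compute a
rational number within `2^(-k)` of `x a`. -/
def UniformlyComputableOn {α : Type} [Primcodable α] (S : Set α) (x : α → ℝ) : Prop :=
  ∃ q : α → ℕ → RatCode, Computable₂ q ∧
    ∀ a ∈ S, ∀ k : ℕ, |x a - ((q a k).val : ℝ)| ≤ (1 / 2 : ℝ) ^ k

/-! ### Schnorr randomness -/

/-- Names of open cubes with rational coordinates: the least corner and the side length. -/
abbrev CubeCode (n : ℕ) : Type := (Fin n → RatCode) × RatCode

/-- The open cube `∏ i, (a i, a i + s)` named by `(a, s)`. A name with `s ≤ 0` names the empty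
set, so that a computable sequence of names may have an empty union. -/
def openCube {n : ℕ} (c : CubeCode n) : Set (Fin n → ℝ) :=
  {x | 0 < c.2.val ∧ ∀ i, ratPoint c.1 i < x i ∧ x i < ratPoint c.1 i + (c.2.val : ℝ)}

/-- `G 0, G 1, …` is a uniformly `Σ⁰₁` sequence of subsets of `[0,1]^n`: each `G m` is the
intersection of `[0,1]^n` with an effective union of open cubes with rational coordinates, where
the enumeration of the cubes is computable uniformly in `m`. -/
def UniformlySigmaOne {n : ℕ} (G : ℕ → Set (Fin n → ℝ)) : Prop :=
  ∃ c : ℕ → ℕ → CubeCode n, Computable₂ c ∧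
    ∀ m, G m = unitCube n ∩ ⋃ i : ℕ, openCube (c m i)

/-- A Schnorr test in `[0,1]^n`. -/
structure IsSchnorrTest {n : ℕ} (G : ℕ → Set (Fin n → ℝ)) : Prop where
  sigmaOne : UniformlySigmaOne G
  measure_le : ∀ m, volume.real (G m) ≤ (1 / 2 : ℝ) ^ m
  measure_computable : UniformlyComputableOn Set.univ (fun m => volume.real (G m))

/-- `z` is Schnorr random: no Schnorr test captures it. -/
def IsSchnorrRandom {n : ℕ} (z : Fin n → ℝ) : Prop :=
  ∀ G : ℕ → Set (Fin n → ℝ), IsSchnorrTest G → z ∉ ⋂ m, G m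

/-! ### `L₁`-computable functions -/

/-- `h 0, h 1, …` restricted to `[0,1]^n` are computable functions, uniformly in the index:
the values at rational points of `[0,1]^n` are uniformly computable reals, and the functions are
effectively uniformly continuous. (`dist` is the distance of the maximum norm; replacing it by the
Euclidean distance changes the computable modulus only.) -/
structure UniformlyComputableFunctions {n : ℕ} (h : ℕ → (Fin n → ℝ) → ℝ) : Prop where
  values : UniformlyComputableOn
    {p : ℕ × (Fin n → RatCode) | ratPoint p.2 ∈ unitCube n} (fun p => h p.1 (ratPoint p.2))
  modulus : ∃ r : ℕ → ℕ → ℕ, Computable₂ r ∧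
    ∀ i k, ∀ x ∈ unitCube n, ∀ y ∈ unitCube n,
      dist x y < (1 / 2 : ℝ) ^ r i k → |h i x - h i y| < (1 / 2 : ℝ) ^ k

/-- `g`, restricted to `[0,1]^n`, is `L₁`-computable: it is integrable, and from `k` one can
determine a computable function on `[0,1]^n` whose `L₁`-distance to `g` is below `2^(-k)`. -/
def IsL1Computable {n : ℕ} (g : (Fin n → ℝ) → ℝ) : Prop :=
  IntegrableOn g (unitCube n) ∧
    ∃ h : ℕ → (Fin n → ℝ) → ℝ, UniformlyComputableFunctions h ∧
      ∀ k, ∫ x in unitCube n, |g x - h k x| < (1 / 2 : ℝ) ^ k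

/-! ### Weak Lebesgue points -/

/-- `Q` is a (closed, axis-parallel, nondegenerate) cube contained in `[0,1]^n`. -/
def IsSubcube {n : ℕ} (Q : Set (Fin n → ℝ)) : Prop :=
  Q ⊆ unitCube n ∧ ∃ (a : Fin n → ℝ) (s : ℝ), 0 < s ∧ Q = Icc a (fun i => a i + s)

/-- `z` is a weak Lebesgue point of `g : [0,1]^n → ℝ`: the averages of `g` over the cubes `Q` with
`z ∈ Q` converge to a real number as the measure of `Q` tends to zero. -/
def IsWeakLebesguePoint {n : ℕ} (g : (Fin n → ℝ) → ℝ) (z : Fin n → ℝ) : Prop :=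
  ∃ L : ℝ, ∀ ε > 0, ∃ δ > 0, ∀ Q : Set (Fin n → ℝ), IsSubcube Q → z ∈ Q →
    volume.real Q < δ → |(volume.real Q)⁻¹ * (∫ x in Q, g x) - L| < ε

end Schnorr

/-! Suppose `z` is Schnorr random and `g` is approximated in `L₁` by continuous `h k`. The
differences `h (2k+2) - h (2k)` have norm at most `2 * 4^(-k)`. Multiplied by `2^k`, they are
approximated from below by a computable, integer-valued step function `F k` with integral at most `2
* 2^(-k)` (`exists_step_approximation`). Call a cell heavy if it lies in a box of cells on which `F
k` has average above `1`. A Vitali covering argument bounds the measure of the heavy cells by a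
constant times `2^(-k)` (`card_le_of_forall_mem_box`). They are decidable, so an effective
Borel–Cantelli lemma (`IsSchnorrRandom.eventually_notMem`) shows that for large `k` no heavy cell
touches `z`. Then every cube `Q` containing `z` satisfies `∫_Q |h (2k+2) - h (2k)| ≤ (3^n + 3) *
2^(-k) * λQ`. Summing, the average of `|g - h (2k)|` over `Q` is `O(2^(-k))` uniformly in `Q`, and
continuity of `h (2k)` gives convergence of the averages of `g`.

Conversely, suppose a Schnorr test `c` captures `z`. Descend through the dyadic cells around a
point. After marking a cell of level `ℓ`, mark the next cell that is visibly contained in member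
`(n+1)ℓ+2` of the test, and flip a parity bit. Let `parityLimit c` be the final parity. Inside a
marked cell it differs from the current parity only on that member, whose measure is at most a
quarter of that of the cell (`abs_average_sub_le`). Around `z` marks never stop (`exists_mark`), so
averages within `1/4` of `0` and of `1` alternate and cannot converge.

The function is `L₁`-computable: because the measures of the test are computable, one can find a
level at which all but a small part of finitely many members has been recognized (`exists_levels`).
The parity at that level is then correct off a small set, and it is a step function that Lipschitz
cutoffs make continuous. -/

/-! ### Computable functions -/

namespace Computable

variable {α β γ σ : Type*} [Primcodable α] [Primcodable β] [Primcodable γ] [Primcodable σ]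

attribute [fun_prop] Computable

@[fun_prop] theorem fun_id : Computable (fun a : α => a) := Computable.id

@[fun_prop] theorem fun_const (c : σ) : Computable (fun _ : α => c) := Computable.const c

@[fun_prop] theorem fun_comp {f : β → γ} {g : α → β} (hf : Computable f) (hg : Computable g) :
    Computable (fun a => f (g a)) := hf.comp hg

@[fun_prop] theorem fun_fst {f : α → β × γ} (hf : Computable f) :
    Computable (fun a => (f a).1) := Computable.fst.comp hf

@[fun_prop] theorem fun_snd {f : α → β × γ} (hf : Computable f) :
    Computable (fun a => (f a).2) := Computable.snd.comp hf

@[fun_prop] theorem prodMk {f : α → β} {g : α → γ} (hf : Computable f) (hg : Computable g) :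
    Computable (fun a => (f a, g a)) := hf.pair hg

@[fun_prop] theorem fin_eval {n : ℕ} (i : Fin n) : Computable (fun v : Fin n → σ => v i) :=
  Computable.fin_app.comp Computable.id (Computable.const i)

@[fun_prop] theorem fin_pi {n : ℕ} {f : α → Fin n → σ} (hf : ∀ i, Computable fun a => f a i) :
    Computable (fun a i => f a i) := by
  have h := Computable.vector_ofFn hf
  have h' : Computable fun a => (List.Vector.ofFn fun i => f a i).get :=
    (Primrec.fin_curry.2 Primrec.vector_get).to_comp.comp h
  exact h'.of_eq fun a => by ext i; simp

section Nat

variable {f g : α → ℕ}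

@[fun_prop] theorem nat_add (hf : Computable f) (hg : Computable g) :
    Computable (fun a => f a + g a) :=
  Primrec.nat_add.to_comp.comp hf hg

@[fun_prop] theorem nat_mul (hf : Computable f) (hg : Computable g) :
    Computable (fun a => f a * g a) :=
  Primrec.nat_mul.to_comp.comp hf hg

@[fun_prop] theorem nat_sub (hf : Computable f) (hg : Computable g) :
    Computable (fun a => f a - g a) :=
  Primrec.nat_sub.to_comp.comp hf hg

@[fun_prop] theorem nat_div (hf : Computable f) (hg : Computable g) :
    Computable (fun a => f a / g a) :=
  Primrec.nat_div.to_comp.comp hf hg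

@[fun_prop] theorem nat_mod (hf : Computable f) (hg : Computable g) :
    Computable (fun a => f a % g a) :=
  Primrec.nat_mod.to_comp.comp hf hg

@[fun_prop] theorem nat_min (hf : Computable f) (hg : Computable g) :
    Computable (fun a => min (f a) (g a)) :=
  Primrec.nat_min.to_comp.comp hf hg

@[fun_prop] theorem decide_lt (hf : Computable f) (hg : Computable g) :
    Computable (fun a => decide (f a < g a)) :=
  Primrec.nat_lt.decide.to_comp.comp hf hg

@[fun_prop] theorem decide_le (hf : Computable f) (hg : Computable g) :
    Computable (fun a => decide (f a ≤ g a)) :=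
  Primrec.nat_le.decide.to_comp.comp hf hg

end Nat

@[fun_prop] theorem bool_and {p q : α → Bool} (hp : Computable p) (hq : Computable q) :
    Computable (fun a => p a && q a) := Primrec.and.to_comp.comp hp hq

@[fun_prop] theorem bool_not {p : α → Bool} (hp : Computable p) :
    Computable (fun a => !p a) := Primrec.not.to_comp.comp hp

@[fun_prop] theorem bool_ite {p : α → Bool} {f g : α → σ} (hp : Computable p)
    (hf : Computable f) (hg : Computable g) : Computable (fun a => if p a then f a else g a) :=
  (Computable.cond hp hf hg).of_eq fun a => by cases p a <;> rfl

theorem nat_iterate {b : α → ℕ} {s : α → σ} {f : α → ℕ → σ → σ} (hb : Computable b)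
    (hs : Computable s) (hf : Computable fun p : α × ℕ × σ => f p.1 p.2.1 p.2.2) :
    Computable (fun a => Nat.rec (motive := fun _ => σ) (s a) (f a) (b a)) :=
  Computable.nat_rec hb hs (h := fun a p => f a p.1 p.2) hf

@[fun_prop] theorem sum_range {f : α → ℕ → ℕ} {b : α → ℕ} (hb : Computable b)
    (hf : Computable fun p : α × ℕ => f p.1 p.2) :
    Computable (fun a => ∑ i ∈ Finset.range (b a), f a i) := by
  have h := nat_iterate (f := fun a i s => s + f a i) hb (Computable.const 0) (by fun_prop)
  refine h.of_eq fun a => ?_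
  induction b a with
  | zero => rfl
  | succ k ih => simp only [Finset.sum_range_succ, ih]

@[fun_prop] theorem nat_pow {f g : α → ℕ} (hf : Computable f) (hg : Computable g) :
    Computable (fun a => f a ^ g a) := by
  have h := nat_iterate (f := fun a _ s => s * f a) hg (Computable.const 1) (by fun_prop)
  refine h.of_eq fun a => ?_
  induction g a with
  | zero => rfl
  | succ k ih => simp only [pow_succ, ih]

@[fun_prop] theorem exists_lt {p : α → ℕ → Bool} {b : α → ℕ} (hb : Computable b)
    (hp : Computable fun q : α × ℕ => p q.1 q.2) :
    Computable (fun a => decide (∃ i < b a, p a i = true)) := by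
  -- A bounded quantifier is decided by counting its witnesses.
  have h : Computable fun a =>
      decide (0 < ∑ i ∈ Finset.range (b a), if p a i = true then 1 else 0) := by fun_prop
  refine h.of_eq fun a => ?_
  simp [Finset.card_pos, Finset.filter_nonempty_iff]

@[fun_prop] theorem fin_prod {n : ℕ} {f : α → Fin n → ℕ} (hf : ∀ i, Computable fun a => f a i) :
    Computable (fun a => ∏ i, f a i) := by
  induction n with
  | zero => simpa using Computable.const 1
  | succ n ih =>
    simp only [Fin.prod_univ_succ]
    have := ih fun i => hf i.succ
    have := hf 0
    fun_prop

@[fun_prop] theorem fin_forall {n : ℕ} {p : α → Fin n → Bool}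
    (hp : ∀ i, Computable fun a => p a i) : Computable (fun a => decide (∀ i, p a i = true)) := by
  induction n with
  | zero => simpa using Computable.const true
  | succ n ih =>
    have h : Computable fun a => p a 0 && decide (∀ i : Fin n, p a i.succ = true) := by
      have := ih fun i => hp i.succ
      have := hp 0
      fun_prop
    refine h.of_eq fun a => ?_
    simp [Fin.forall_fin_succ]

/-- Unbounded search for a predicate that is satisfied everywhere. -/
theorem exists_search {p : α → ℕ → Bool} (hp : Computable fun q : α × ℕ => p q.1 q.2)
    (h : ∀ a, ∃ i, p a i = true) : ∃ f : α → ℕ, Computable f ∧ ∀ a, p a (f a) = true := by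
  have hd : ∀ a, (Nat.rfind fun i => (Part.some (p a i) : Part Bool)).Dom := fun a => by
    obtain ⟨i, hi⟩ := h a
    exact Nat.rfind_dom.2 ⟨i, by simp [hi], fun _ => trivial⟩
  have hr : Partrec fun a => Nat.rfind fun i => (Part.some (p a i) : Part Bool) :=
    Partrec.rfind (p := fun a i => Part.some (p a i)) hp.partrec
  refine ⟨fun a => (Nat.rfind _).get (hd a), hr.of_eq_tot fun a => Part.get_mem _, fun a => ?_⟩
  simpa using Nat.rfind_spec (Part.get_mem (hd a))

end Computable

namespace Schnorr

open MeasureTheory Set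

variable {n : ℕ}

/-! ### Dyadic cells -/

/-- The half-open unit cube `[0,1)^n`. -/
def halfCube (n : ℕ) : Set (Fin n → ℝ) := univ.pi fun _ => Ico 0 1

/-- The half-open dyadic cell of side `2^(-N)` with index `v`. -/
def cell (N : ℕ) (v : Fin n → ℕ) : Set (Fin n → ℝ) :=
  univ.pi fun i => Ico ((v i : ℝ) / 2 ^ N) (((v i : ℝ) + 1) / 2 ^ N)

/-- The index of the dyadic cell of side `2^(-N)` containing `x`. -/
noncomputable def cellIndex (N : ℕ) (x : Fin n → ℝ) : Fin n → ℕ := fun i => ⌊x i * 2 ^ N⌋₊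

/-- The first `n` digits of `p` in base `b`. -/
def digits (n b p : ℕ) : Fin n → ℕ := fun i => p / b ^ (i : ℕ) % b

/-- The indices `u` with `v i ≤ u i < v i + l` for all `i`. -/
def box (v : Fin n → ℕ) (l : ℕ) : Finset (Fin n → ℕ) :=
  Fintype.piFinset fun i => Finset.Ico (v i) (v i + l)

theorem mem_box {v u : Fin n → ℕ} {l : ℕ} : u ∈ box v l ↔ ∀ i, v i ≤ u i ∧ u i < v i + l := by
  simp [box]

@[fun_prop] theorem computable_digits {α : Type*} [Primcodable α] {b p : α → ℕ}
    (hb : Computable b) (hp : Computable p) : Computable fun a => digits n (b a) (p a) := by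
  unfold digits
  fun_prop

theorem digits_mem_box {b p : ℕ} (hb : 0 < b) : digits n b p ∈ box 0 b := by
  simp [mem_box, digits, Nat.mod_lt _ hb]

/-- Base-`b` digits enumerate the cells, so sums over cells become sums over an initial segment of
`ℕ`, the form in which computability is proved. -/
theorem sum_digits {M : Type*} [AddCommMonoid M] {b : ℕ} (f : (Fin n → ℕ) → M) :
    ∑ p ∈ Finset.range (b ^ n), f (digits n b p) = ∑ u ∈ box 0 b, f u := by
  rw [← Fin.sum_univ_eq_sum_range (fun p => f (digits n b p)),
    ← Equiv.sum_comp (finFunctionFinEquiv (m := b) (n := n))]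
  refine Finset.sum_bij' (fun v _ i => (v i : ℕ))
    (fun u hu i => ⟨u i, by simpa using (mem_box.1 hu i).2⟩) ?_ ?_ ?_ ?_ ?_
  · intro v _
    simp [mem_box]
  · intro u _
    simp
  · intro v _
    rfl
  · intro u _
    rfl
  · intro v _
    congr 1
    funext i
    have h := congrArg Fin.val (congrFun (finFunctionFinEquiv.symm_apply_apply v) i)
    simpa [finFunctionFinEquiv, digits] using h

theorem exists_digits {b : ℕ} {v : Fin n → ℕ} (hv : ∀ i, v i < b) :
    ∃ p < b ^ n, digits n b p = v := by
  by_contra! h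
  -- Sum the indicator of `v`: an unattained `v` would give `0 = 1`.
  have h1 := sum_digits (n := n) (b := b) fun u => if u = v then 1 else 0
  rw [Finset.sum_eq_zero, Finset.sum_ite_eq', if_pos] at h1
  · exact zero_ne_one h1
  · simpa [mem_box] using hv
  · intro p hp
    exact if_neg (h p (Finset.mem_range.1 hp))

theorem mem_halfCube {x : Fin n → ℝ} : x ∈ halfCube n ↔ ∀ i, 0 ≤ x i ∧ x i < 1 := by
  simp [halfCube]

theorem mem_unitCube {x : Fin n → ℝ} : x ∈ unitCube n ↔ ∀ i, 0 ≤ x i ∧ x i ≤ 1 := by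
  simp [unitCube, Pi.le_def, forall_and]

theorem mem_cell {N : ℕ} {v : Fin n → ℕ} {x : Fin n → ℝ} :
    x ∈ cell N v ↔ ∀ i, (v i : ℝ) ≤ x i * 2 ^ N ∧ x i * 2 ^ N < v i + 1 := by
  simp [cell, div_le_iff₀, lt_div_iff₀]

theorem halfCube_subset_unitCube : halfCube n ⊆ unitCube n := fun _ hx =>
  mem_unitCube.2 fun i => ⟨(mem_halfCube.1 hx i).1, (mem_halfCube.1 hx i).2.le⟩

theorem measurableSet_halfCube : MeasurableSet (halfCube n) :=
  MeasurableSet.univ_pi fun _ => measurableSet_Ico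

theorem measurableSet_cell (N : ℕ) (v : Fin n → ℕ) : MeasurableSet (cell N v) :=
  MeasurableSet.univ_pi fun _ => measurableSet_Ico

theorem halfCube_ae_eq : halfCube n =ᵐ[volume] unitCube n := by
  have h := Measure.univ_pi_Ico_ae_eq_Icc (μ := fun _ : Fin n => (volume : Measure ℝ))
    (f := 0) (g := 1)
  simpa [halfCube, unitCube, volume_pi] using h

theorem volume_unitCube : volume (unitCube n) = 1 := by
  simp [unitCube, Real.volume_Icc_pi]

theorem volume_halfCube : volume (halfCube n) = 1 :=
  (measure_congr halfCube_ae_eq).trans volume_unitCube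

theorem volume_real_cell (N : ℕ) (v : Fin n → ℕ) :
    volume.real (cell N v) = 1 / ((2 : ℝ) ^ N) ^ n := by
  have h : ∀ i, ((v i : ℝ) + 1) / 2 ^ N - v i / 2 ^ N = 1 / 2 ^ N := fun i => by ring
  rw [measureReal_def, cell, Real.volume_pi_Ico]
  simp only [h, Finset.prod_const, ENNReal.toReal_pow, Finset.card_univ, Fintype.card_fin]
  rw [ENNReal.toReal_ofReal (by positivity), one_div_pow]

theorem volume_cell_ne_top (N : ℕ) (v : Fin n → ℕ) : volume (cell N v) ≠ ⊤ := by
  simp [cell, Real.volume_pi_Ico, ENNReal.prod_ne_top]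

theorem mem_cell_iff {N : ℕ} {v : Fin n → ℕ} {x : Fin n → ℝ} (hx : ∀ i, 0 ≤ x i) :
    x ∈ cell N v ↔ cellIndex N x = v := by
  rw [mem_cell, funext_iff]
  refine forall_congr' fun i => ?_
  rw [cellIndex, Nat.floor_eq_iff (mul_nonneg (hx i) (by positivity))]

theorem cellIndex_lt {N : ℕ} {x : Fin n → ℝ} (hx : x ∈ halfCube n) (i : Fin n) :
    cellIndex N x i < 2 ^ N := by
  have h := mem_halfCube.1 hx i
  rw [cellIndex, Nat.floor_lt (mul_nonneg h.1 (by positivity))]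
  push_cast
  nlinarith [h.2, pow_pos (two_pos (α := ℝ)) N]

theorem cellIndex_mem_box {N : ℕ} {x : Fin n → ℝ} (hx : x ∈ halfCube n) :
    cellIndex N x ∈ box 0 (2 ^ N) := by
  simpa [mem_box] using cellIndex_lt hx

theorem cell_subset_halfCube {N : ℕ} {v : Fin n → ℕ} (hv : ∀ i, v i < 2 ^ N) :
    cell N v ⊆ halfCube n := by
  intro x hx
  refine mem_halfCube.2 fun i => ?_
  have h := mem_cell.1 hx i
  have hp := pow_pos (two_pos (α := ℝ)) N
  have hv' : (v i : ℝ) + 1 ≤ 2 ^ N := by exact_mod_cast hv i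
  constructor
  · by_contra! hneg
    nlinarith [h.1, Nat.cast_nonneg (α := ℝ) (v i)]
  · by_contra! hge
    nlinarith [h.2]

/-- Division by `2 ^ (S - N)` drops the last `S - N` binary digits. -/
theorem cellIndex_coarsen {N S : ℕ} (h : N ≤ S) (x : Fin n → ℝ) :
    cellIndex N x = fun i => cellIndex S x i / 2 ^ (S - N) := by
  funext i
  have := Nat.floor_div_natCast (x i * 2 ^ S) (2 ^ (S - N))
  rw [cellIndex, cellIndex, ← this]
  congr 1
  push_cast
  rw [mul_div_assoc, ← Nat.sub_add_cancel h, pow_add]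
  simp

theorem measurable_cellIndex (N : ℕ) : Measurable (cellIndex (n := n) N) :=
  measurable_pi_lambda _ fun i =>
    Nat.measurable_floor.comp ((measurable_pi_apply i).mul_const _)

theorem halfCube_eq_biUnion (N : ℕ) : halfCube n = ⋃ v ∈ box 0 (2 ^ N), cell N v := by
  ext x
  simp only [mem_iUnion, exists_prop]
  constructor
  · intro hx
    exact ⟨_, cellIndex_mem_box hx, (mem_cell_iff fun i => (mem_halfCube.1 hx i).1).2 rfl⟩
  · rintro ⟨v, hv, hx⟩
    exact cell_subset_halfCube (fun i => by simpa using (mem_box.1 hv i).2) hx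

/-! ### Integrals of step functions and measures of unions of cells, as finite sums. -/

theorem setIntegral_cellIndex (N : ℕ) (F : (Fin n → ℕ) → ℝ) :
    ∫ x in halfCube n, F (cellIndex N x) = (∑ u ∈ box 0 (2 ^ N), F u) / ((2 : ℝ) ^ N) ^ n := by
  have hnn : ∀ v ∈ box 0 (2 ^ N), ∀ x ∈ cell N v, cellIndex N x = (v : Fin n → ℕ) := by
    intro v hv x hx
    have := cell_subset_halfCube (fun i => by simpa using (mem_box.1 hv i).2) hx
    exact (mem_cell_iff fun i => (mem_halfCube.1 this i).1).1 hx
  rw [halfCube_eq_biUnion N, integral_biUnion_finset _ fun v _ => measurableSet_cell N v]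
  · rw [Finset.sum_div]
    refine Finset.sum_congr rfl fun v hv => ?_
    rw [setIntegral_congr_fun (measurableSet_cell N v) (g := fun _ => F v)
      fun x hx => by simp [hnn v hv x hx]]
    rw [setIntegral_const, volume_real_cell, smul_eq_mul]
    ring
  · intro v hv w hw hvw
    rw [Function.onFun, Set.disjoint_left]
    intro x hx hx'
    exact hvw ((hnn v hv x hx).symm.trans (hnn w hw x hx'))
  · intro v hv
    refine (integrableOn_const (C := F v) (volume_cell_ne_top N v)).congr_fun
      (fun x hx => by simp [hnn v hv x hx]) (measurableSet_cell N v)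

theorem integrableOn_cellIndex (N : ℕ) (F : (Fin n → ℕ) → ℝ) :
    IntegrableOn (fun x => F (cellIndex N x)) (halfCube n) := by
  have hm : Measurable fun x : Fin n → ℝ => F (cellIndex N x) :=
    Measurable.of_discrete.comp (measurable_cellIndex N)
  refine Measure.integrableOn_of_bounded (M := ∑ u ∈ box 0 (2 ^ N), ‖F u‖)
    (by simp [volume_halfCube]) hm.aestronglyMeasurable ?_
  refine (ae_restrict_iff' measurableSet_halfCube).2 (.of_forall fun x hx => ?_)
  exact Finset.single_le_sum (f := fun u => ‖F u‖) (fun _ _ => norm_nonneg _)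
    (cellIndex_mem_box hx)

theorem measurableSet_cellIndex (N : ℕ) (P : (Fin n → ℕ) → Prop) :
    MeasurableSet {x ∈ halfCube n | P (cellIndex N x)} :=
  measurableSet_halfCube.inter (measurable_cellIndex N (MeasurableSet.of_discrete (s := {v | P v})))

theorem volume_real_cellIndex (N : ℕ) (P : (Fin n → ℕ) → Prop) [DecidablePred P] :
    volume.real {x ∈ halfCube n | P (cellIndex N x)} =
      ({u ∈ box 0 (2 ^ N) | P u}.card : ℝ) / ((2 : ℝ) ^ N) ^ n := by
  have h := setIntegral_cellIndex (n := n) N fun u => if P u then 1 else 0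
  rw [Finset.sum_boole] at h
  rw [← h, ← setIntegral_one_eq_measureReal, ← integral_indicator (measurableSet_cellIndex N P),
    ← integral_indicator measurableSet_halfCube]
  congr 1
  funext x
  by_cases hx : x ∈ halfCube n <;> by_cases hP : P (cellIndex N x) <;> simp [indicator, hx, hP]

theorem volume_ne_top_of_subset {s : Set (Fin n → ℝ)} (hs : s ⊆ unitCube n) : volume s ≠ ⊤ :=
  ((measure_mono hs).trans_lt (by simp [volume_unitCube])).ne

theorem measureReal_iUnion_le_geometric {B : ℕ → Set (Fin n → ℝ)} {c : ℝ}
    (hB : ∀ k, B k ⊆ unitCube n) (h : ∀ k, volume.real (B k) ≤ c * (1 / 2) ^ k) :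
    volume.real (⋃ k, B k) ≤ 2 * c := by
  have hc : 0 ≤ c := by simpa using measureReal_nonneg.trans (h 0)
  have hs : Summable fun k : ℕ => c * (1 / 2 : ℝ) ^ k := summable_geometric_two.mul_left c
  refine ENNReal.toReal_le_of_le_ofReal (by positivity) ?_
  calc volume (⋃ k, B k) ≤ ∑' k, volume (B k) := measure_iUnion_le _
    _ ≤ ∑' k : ℕ, ENNReal.ofReal (c * (1 / 2) ^ k) := by
        refine ENNReal.tsum_le_tsum fun k => ?_
        rw [← ENNReal.ofReal_toReal (volume_ne_top_of_subset (hB k))]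
        exact ENNReal.ofReal_le_ofReal (h k)
    _ = ENNReal.ofReal (2 * c) := by
        rw [← ENNReal.ofReal_tsum_of_nonneg (fun k => by positivity) hs, tsum_mul_left,
          tsum_geometric_two, mul_comm]

/-- The faces of the dyadic cells are null, so open cubes may be exchanged with unions of half-open
cells when measuring. -/
theorem ae_ne_dyadic : ∀ᵐ x : Fin n → ℝ, ∀ (i : Fin n) (N : ℕ) (j : ℤ), x i * 2 ^ N ≠ j := by
  refine ae_all_iff.2 fun i => ae_all_iff.2 fun N => ae_all_iff.2 fun j => ?_
  have h : ∀ᵐ x : Fin n → ℝ, x i ≠ j / 2 ^ N := by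
    rw [volume_pi]
    exact Measure.ae_eval_ne _ i _
  filter_upwards [h] with x hx hx'
  exact hx (by rw [← hx']; simp)

theorem cell_index_bounds {N : ℕ} {x : Fin n → ℝ} (hx : x ∈ unitCube n) (i : Fin n) :
    (cellIndex N x i : ℝ) ≤ x i * 2 ^ N ∧ x i * 2 ^ N < cellIndex N x i + 1 :=
  ⟨Nat.floor_le (mul_nonneg (mem_unitCube.1 hx i).1 (by positivity)), Nat.lt_floor_add_one _⟩

end Schnorr

namespace Schnorr

open MeasureTheory Set

variable {n : ℕ}

/-! ### An effective Borel–Cantelli lemma -/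

attribute [fun_prop] Computable.unpair

attribute [local irreducible] Computable

theorem RatCode.cast_val (p : RatCode) :
    ((RatCode.val p : ℚ) : ℝ) = ((p.1 : ℝ) - p.2.1) / (p.2.2 + 1) := by
  simp [RatCode.val]

theorem RatCode.cast_val_pred (a b c : ℕ) (hc : 0 < c) :
    ((RatCode.val (a, b, c - 1) : ℚ) : ℝ) = ((a : ℝ) - b) / c := by
  rw [RatCode.cast_val]
  simp [Nat.cast_sub (Nat.succ_le_iff.2 hc)]

/-- The predicate "the cell `w` touches one of the cells in `[0,1]^n` that satisfy `P`". -/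
def inflate (N : ℕ) (P : (Fin n → ℕ) → Bool) (w : Fin n → ℕ) : Bool :=
  decide (∃ p < (2 ^ N) ^ n, (P (digits n (2 ^ N) p) &&
    decide (∀ i, (decide (digits n (2 ^ N) p i ≤ w i + 1) &&
      decide (w i ≤ digits n (2 ^ N) p i + 1)) = true)) = true)

@[fun_prop] theorem computable_inflate {α : Type*} [Primcodable α] {N : α → ℕ}
    {P : α → (Fin n → ℕ) → Bool} {w : α → Fin n → ℕ} (hN : Computable N)
    (hP : Computable fun q : α × (Fin n → ℕ) => P q.1 q.2) (hw : Computable w) :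
    Computable fun a => inflate (N a) (P a) (w a) := by
  unfold inflate
  fun_prop

theorem inflate_iff {N : ℕ} {P : (Fin n → ℕ) → Bool} {w : Fin n → ℕ} :
    inflate N P w = true ↔
      ∃ u ∈ box 0 (2 ^ N), P u = true ∧ ∀ i, u i ≤ w i + 1 ∧ w i ≤ u i + 1 := by
  simp only [inflate, decide_eq_true_eq, Bool.and_eq_true]
  constructor
  · rintro ⟨p, -, h⟩
    exact ⟨_, digits_mem_box (by positivity), h⟩
  · rintro ⟨u, hu, h⟩
    obtain ⟨p, hp, rfl⟩ := exists_digits (v := u) fun i => by simpa using (mem_box.1 hu i).2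
    exact ⟨p, hp, h⟩

/-- A cell touches at most `3^n` cells, itself included. -/
theorem card_inflate_le (N : ℕ) (P : (Fin n → ℕ) → Bool) (s : Finset (Fin n → ℕ)) :
    {w ∈ s | inflate N P w = true}.card ≤ 3 ^ n * {u ∈ box 0 (2 ^ N) | P u = true}.card := by
  classical
  calc {w ∈ s | inflate N P w = true}.card
      ≤ ({u ∈ box 0 (2 ^ N) | P u = true}.biUnion fun u =>
          Fintype.piFinset fun i => Finset.Icc (u i - 1) (u i + 1)).card := by
        refine Finset.card_le_card fun w hw => ?_
        obtain ⟨u, hu, hP, h⟩ := inflate_iff.1 (Finset.mem_filter.1 hw).2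
        refine Finset.mem_biUnion.2 ⟨u, Finset.mem_filter.2 ⟨hu, hP⟩, ?_⟩
        refine Fintype.mem_piFinset.2 fun i => Finset.mem_Icc.2 ?_
        have := h i
        omega
    _ ≤ {u ∈ box 0 (2 ^ N) | P u = true}.card * 3 ^ n := by
        refine Finset.card_biUnion_le_card_mul _ _ _ fun u _ => ?_
        rw [Fintype.card_piFinset]
        calc ∏ i, (Finset.Icc (u i - 1) (u i + 1)).card ≤ ∏ _i : Fin n, 3 :=
              Finset.prod_le_prod' fun i _ => by rw [Nat.card_Icc]; omega
          _ = 3 ^ n := by simp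
    _ = _ := mul_comm _ _

/-- The name of the open cube of side `3 * 2^(-N)` concentric with the cell `w`. -/
def cellNbhd (N : ℕ) (w : Fin n → ℕ) : CubeCode n :=
  (fun i => (w i, 1, 2 ^ N - 1), (3, 0, 2 ^ N - 1))

@[fun_prop] theorem computable_cellNbhd {α : Type*} [Primcodable α] {N : α → ℕ}
    {w : α → Fin n → ℕ} (hN : Computable N) (hw : Computable w) :
    Computable fun a => cellNbhd (N a) (w a) := by
  unfold cellNbhd
  fun_prop

theorem mem_openCube_cellNbhd {N : ℕ} {w : Fin n → ℕ} {x : Fin n → ℝ} :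
    x ∈ openCube (cellNbhd N w) ↔ ∀ i, (w i : ℝ) - 1 < x i * 2 ^ N ∧ x i * 2 ^ N < w i + 2 := by
  have hp := pow_pos (two_pos (α := ℝ)) N
  have hs : ((RatCode.val (3, 0, 2 ^ N - 1) : ℚ) : ℝ) = 3 / 2 ^ N := by
    rw [RatCode.cast_val_pred _ _ _ (by positivity)]
    norm_num
  have hs0 : 0 < RatCode.val (3, 0, 2 ^ N - 1) := by
    rw [← Rat.cast_pos (K := ℝ), hs]
    positivity
  simp only [openCube, cellNbhd, mem_ofPred_eq, hs0, true_and, hs, ratPoint]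
  refine forall_congr' fun i => ?_
  rw [RatCode.cast_val_pred _ _ _ (by positivity)]
  push_cast
  rw [← add_div, div_lt_iff₀ hp, lt_div_iff₀ hp]
  ring_nf

/-- The empty cube. -/
def emptyCode : CubeCode n := (fun _ => (0, 0, 0), (0, 0, 0))

theorem openCube_emptyCode : openCube (emptyCode : CubeCode n) = ∅ := by
  ext x
  simp [openCube, emptyCode, RatCode.val]

section BorelCantelli

variable {N : ℕ → ℕ} {P : ℕ → (Fin n → ℕ) → Bool}

/-- The cubes of the Schnorr test made from the cells satisfying `P k`, with `k ≥ m + b`. -/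
def badCubes (N : ℕ → ℕ) (P : ℕ → (Fin n → ℕ) → Bool) (b m i : ℕ) : CubeCode n :=
  -- The index `i` codes an offset and a number whose digits name a cell; large numbers merely
  -- repeat cells.
  if P (m + b + i.unpair.1) (digits n (2 ^ N (m + b + i.unpair.1)) i.unpair.2) then
    cellNbhd (N (m + b + i.unpair.1)) (digits n (2 ^ N (m + b + i.unpair.1)) i.unpair.2)
  else emptyCode

theorem mem_iUnion_badCubes {b m : ℕ} {x : Fin n → ℝ} :
    x ∈ ⋃ i, openCube (badCubes N P b m i) ↔
      ∃ k, ∃ w ∈ box 0 (2 ^ N (m + b + k)), P (m + b + k) w = true ∧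
        x ∈ openCube (cellNbhd (N (m + b + k)) w) := by
  rw [mem_iUnion]
  constructor
  · rintro ⟨i, hi⟩
    unfold badCubes at hi
    split_ifs at hi with h
    · exact ⟨i.unpair.1, _, digits_mem_box (by positivity), h, hi⟩
    · simp [openCube_emptyCode] at hi
  · rintro ⟨k, w, hw, hP, hx⟩
    obtain ⟨p, -, rfl⟩ := exists_digits (v := w) fun i => by simpa using (mem_box.1 hw i).2
    refine ⟨Nat.pair k p, ?_⟩
    simpa [badCubes, hP] using hx

/-- The points whose cell touches a cell satisfying `P k`. -/
def inflatedSet (N : ℕ → ℕ) (P : ℕ → (Fin n → ℕ) → Bool) (k : ℕ) : Set (Fin n → ℝ) :=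
  {x ∈ halfCube n | inflate (N k) (P k) (cellIndex (N k) x) = true}

/-- The threefold open cube around a cell is, up to dyadic faces, the union of the cells touching
it. Thus the open sets of the test can be measured by counting cells, while they still contain the
closed cells. -/
theorem badCubes_ae_eq (b m : ℕ) :
    (unitCube n ∩ ⋃ i, openCube (badCubes N P b m i) : Set (Fin n → ℝ)) =ᵐ[volume]
      ⋃ k, inflatedSet N P (m + b + k) := by
  filter_upwards [ae_ne_dyadic, halfCube_ae_eq.mem_iff] with x hx hc
  refine propext ?_
  change x ∈ unitCube n ∩ _ ↔ x ∈ ⋃ k, _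
  rw [mem_inter_iff, mem_iUnion_badCubes, mem_iUnion, ← hc, ← exists_and_left]
  refine exists_congr fun k => ?_
  rw [inflatedSet, mem_ofPred_eq, inflate_iff]
  refine and_congr_right fun h1 => exists_congr fun w => and_congr_right fun _ =>
    and_congr_right fun _ => ?_
  rw [mem_openCube_cellNbhd]
  refine forall_congr' fun i => ?_
  obtain ⟨h2, h3⟩ := cell_index_bounds (N := N (m + b + k)) (halfCube_subset_unitCube h1) i
  have h4 := hx i (N (m + b + k)) (w i - 1)
  push_cast at h4
  generalize cellIndex (N (m + b + k)) x i = u at *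
  constructor
  · rintro ⟨h5, h6⟩
    constructor
    · have : (w i : ℝ) < u + 2 := by linarith
      have : w i < u + 2 := by exact_mod_cast this
      omega
    · have : (u : ℝ) < w i + 2 := by linarith
      have : u < w i + 2 := by exact_mod_cast this
      omega
  · rintro ⟨h5, h6⟩
    have h5' : (w i : ℝ) ≤ u + 1 := by exact_mod_cast h5
    have h6' : (u : ℝ) ≤ w i + 1 := by exact_mod_cast h6
    exact ⟨lt_of_le_of_ne (by linarith) h4.symm, by linarith⟩

theorem volume_inflatedSet_le {C : ℕ} (k : ℕ)
    (hC : volume.real {x ∈ halfCube n | P k (cellIndex (N k) x) = true} ≤ C * (1 / 2) ^ k) :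
    volume.real (inflatedSet N P k) ≤ 3 ^ n * C * (1 / 2) ^ k := by
  rw [volume_real_cellIndex (P := fun v => P k v = true)] at hC
  rw [inflatedSet, volume_real_cellIndex (P := fun v => inflate (N k) (P k) v = true)]
  calc _ ≤ ((3 ^ n * {u ∈ box 0 (2 ^ N k) | P k u = true}.card : ℕ) : ℝ) /
        ((2 : ℝ) ^ N k) ^ n := by
        gcongr
        exact card_inflate_le _ _ _
    _ = 3 ^ n * (({u ∈ box 0 (2 ^ N k) | P k u = true}.card : ℝ) / ((2 : ℝ) ^ N k) ^ n) := by
        push_cast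
        ring
    _ ≤ 3 ^ n * (C * (1 / 2) ^ k) := by gcongr
    _ = _ := by ring

/-- The level at which `⋃ j < e, inflatedSet N P (m + j)` is a union of cells. -/
def unionLevel (N : ℕ → ℕ) (m e : ℕ) : ℕ := ∑ j ∈ Finset.range e, N (m + j)

/-- The number of cells of `⋃ j < e, inflatedSet N P (m + j)`. -/
def unionCount (N : ℕ → ℕ) (P : ℕ → (Fin n → ℕ) → Bool) (m e : ℕ) : ℕ :=
  ∑ p ∈ Finset.range ((2 ^ unionLevel N m e) ^ n),
    if decide (∃ j < e, inflate (N (m + j)) (P (m + j)) (fun i =>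
      digits n (2 ^ unionLevel N m e) p i / 2 ^ (unionLevel N m e - N (m + j))) = true)
    then 1 else 0

theorem computable_unionLevel (hN : Computable N) :
    Computable fun p : ℕ × ℕ => unionLevel N p.1 p.2 := by
  unfold unionLevel
  fun_prop

theorem computable_unionCount (hN : Computable N)
    (hP : Computable fun q : ℕ × (Fin n → ℕ) => P q.1 q.2) :
    Computable fun p : ℕ × ℕ => unionCount N P p.1 p.2 := by
  have h := computable_unionLevel hN
  unfold unionCount
  fun_prop

theorem volume_biUnion_inflatedSet (m e : ℕ) :
    volume.real (⋃ j ∈ Finset.range e, inflatedSet N P (m + j)) =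
      unionCount N P m e / ((2 : ℝ) ^ unionLevel N m e) ^ n := by
  have hset : (⋃ j ∈ Finset.range e, inflatedSet N P (m + j)) = {x ∈ halfCube n |
      ∃ j < e, inflate (N (m + j)) (P (m + j)) (fun i =>
        cellIndex (unionLevel N m e) x i / 2 ^ (unionLevel N m e - N (m + j))) = true} := by
    ext x
    simp only [mem_iUnion, Finset.mem_range, exists_prop, inflatedSet, mem_ofPred_eq]
    rw [← exists_and_left]
    refine exists_congr fun j => ?_
    rw [and_left_comm]
    refine and_congr_right fun _ => and_congr_right fun hj => ?_
    rw [← cellIndex_coarsen]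
    -- The sum of the levels dominates each of them and so serves as a common refinement.
    exact Finset.single_le_sum (f := fun j => N (m + j)) (fun _ _ => Nat.zero_le _)
      (Finset.mem_range.2 hj)
  rw [hset, volume_real_cellIndex (P := fun v => ∃ j < e, inflate (N (m + j)) (P (m + j))
    (fun i => v i / 2 ^ (unionLevel N m e - N (m + j))) = true), unionCount, sum_digits
    (fun v => if decide (∃ j < e, inflate (N (m + j)) (P (m + j))
    (fun i => v i / 2 ^ (unionLevel N m e - N (m + j))) = true) = true then 1 else 0)]
  simp

/-- The shift `b` absorbs the factor `3^n * C` from inflation and the factor `2` from the geometric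
series. The measure is computable because the first `e` inflated sets can be counted exactly at a
common level, while the rest has measure at most `2^(-e)`. -/
theorem isSchnorrTest_badCubes {C b : ℕ} (hN : Computable N)
    (hP : Computable fun q : ℕ × (Fin n → ℕ) => P q.1 q.2)
    (hC : ∀ k, volume.real {x ∈ halfCube n | P k (cellIndex (N k) x) = true} ≤
      C * (1 / 2) ^ k) (hb : 2 * (3 ^ n * C) ≤ 2 ^ b) :
    IsSchnorrTest fun m => (unitCube n ∩ ⋃ i, openCube (badCubes N P b m i)) := by
  have hsub : ∀ k, inflatedSet N P k ⊆ unitCube n := fun k x hx =>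
    halfCube_subset_unitCube hx.1
  have hb' : 2 * (3 ^ n * (C : ℝ)) * (1 / 2) ^ b ≤ 1 := by
    have : 2 * (3 ^ n * (C : ℝ)) ≤ 2 ^ b := by exact_mod_cast hb
    calc _ ≤ (2 : ℝ) ^ b * (1 / 2) ^ b := by gcongr
      _ = 1 := by rw [← mul_pow]; norm_num
  have htail : ∀ m, volume.real (⋃ k, inflatedSet N P (m + b + k)) ≤ (1 / 2) ^ m := fun m => by
    refine (measureReal_iUnion_le_geometric (c := 3 ^ n * C * (1 / 2) ^ (m + b))
      (fun k => hsub _) fun k => ?_).trans ?_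
    · refine (volume_inflatedSet_le _ (hC _)).trans_eq ?_
      rw [mul_assoc _ ((1 / 2 : ℝ) ^ (m + b)), ← pow_add]
    · calc _ = (2 * (3 ^ n * (C : ℝ)) * (1 / 2) ^ b) * (1 / 2) ^ m := by rw [pow_add]; ring
        _ ≤ 1 * (1 / 2) ^ m := by gcongr
        _ = _ := one_mul _
  have hvol : ∀ m, volume.real (unitCube n ∩ ⋃ i, openCube (badCubes N P b m i)) =
      volume.real (⋃ k, inflatedSet N P (m + b + k)) := fun m =>
    measureReal_congr (badCubes_ae_eq b m)
  refine ⟨⟨badCubes N P b, ?_, fun _ => rfl⟩, fun m => (hvol m).trans_le (htail m), ?_⟩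
  · change Computable fun p : ℕ × ℕ => badCubes N P b p.1 p.2
    unfold badCubes
    fun_prop
  · refine ⟨fun m e => (unionCount N P (m + b) e, 0, (2 ^ unionLevel N (m + b) e) ^ n - 1),
      ?_, ?_⟩
    · have h1 := computable_unionCount hN hP
      have h2 := computable_unionLevel hN
      change Computable fun p : ℕ × ℕ => (unionCount N P (p.1 + b) p.2, 0,
        (2 ^ unionLevel N (p.1 + b) p.2) ^ n - 1)
      fun_prop
    · intro m _ e
      beta_reduce
      rw [hvol, RatCode.cast_val_pred _ _ _ (by positivity)]
      push_cast
      rw [sub_zero, ← volume_biUnion_inflatedSet]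
      have hfin : ∀ s : Set (Fin n → ℝ), s ⊆ unitCube n → volume s ≠ ⊤ := fun s =>
        volume_ne_top_of_subset
      have h1 : volume.real (⋃ j ∈ Finset.range e, inflatedSet N P (m + b + j)) ≤
          volume.real (⋃ k, inflatedSet N P (m + b + k)) :=
        measureReal_mono (iUnion₂_subset fun j _ => subset_iUnion
          (fun k => inflatedSet N P (m + b + k)) j) (hfin _ (iUnion_subset fun k => hsub _))
      have h2 : volume.real (⋃ k, inflatedSet N P (m + b + k)) ≤
          volume.real (⋃ j ∈ Finset.range e, inflatedSet N P (m + b + j)) +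
            volume.real (⋃ k, inflatedSet N P (m + e + b + k)) := by
        refine (measureReal_mono ?_ (hfin _ (union_subset (iUnion₂_subset fun j _ => hsub _)
          (iUnion_subset fun k => hsub _)))).trans (measureReal_union_le _ _)
        refine iUnion_subset fun k => ?_
        rcases lt_or_ge k e with hk | hk
        · exact (subset_biUnion_of_mem (u := fun j => inflatedSet N P (m + b + j))
            (Finset.mem_coe.2 (Finset.mem_range.2 hk))).trans subset_union_left
        -- What remains after `e` sets is the tail belonging to index `m + e`, so `htail` bounds it.
        · have hk' : m + b + k = m + e + b + (k - e) := by omega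
          rw [hk']
          exact (subset_iUnion (fun k => inflatedSet N P (m + e + b + k)) _).trans
            subset_union_right
      have h3 : (1 / 2 : ℝ) ^ (m + e) ≤ (1 / 2) ^ e :=
        pow_le_pow_of_le_one (by norm_num) (by norm_num) (by omega)
      rw [abs_of_nonneg (by linarith)]
      linarith [htail (m + e)]

/-- An effective Borel–Cantelli lemma: a Schnorr random point lies in cells satisfying `P k` for
finitely many `k` only, if these cells are decidable and have summable measure. -/
theorem IsSchnorrRandom.eventually_notMem {z : Fin n → ℝ} (hz : IsSchnorrRandom z)
    (hzc : z ∈ unitCube n) (hN : Computable N)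
    (hP : Computable fun q : ℕ × (Fin n → ℕ) => P q.1 q.2) {C : ℕ}
    (hC : ∀ k, volume.real {x ∈ halfCube n | P k (cellIndex (N k) x) = true} ≤
      C * (1 / 2) ^ k) :
    ∃ K, ∀ k ≥ K, ∀ w ∈ box 0 (2 ^ N k), P k w = true →
      ¬ ∀ i, (w i : ℝ) ≤ z i * 2 ^ N k ∧ z i * 2 ^ N k ≤ w i + 1 := by
  obtain ⟨b, hb⟩ : ∃ b, 2 * (3 ^ n * C) ≤ 2 ^ b := ⟨_, Nat.lt_two_pow_self.le⟩
  have h := hz _ (isSchnorrTest_badCubes hN hP hC hb)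
  rw [mem_iInter] at h
  obtain ⟨m, hm⟩ := not_forall.1 h
  refine ⟨m + b, fun k hk w hw hPw hzw => hm ⟨hzc, mem_iUnion_badCubes.2 ⟨k - (m + b), ?_⟩⟩⟩
  rw [Nat.add_sub_cancel' hk]
  refine ⟨w, hw, hPw, mem_openCube_cellNbhd.2 fun i => ?_⟩
  have := hzw i
  constructor <;> linarith

end BorelCantelli

end Schnorr

namespace Schnorr

open MeasureTheory Set

variable {n : ℕ}

attribute [local irreducible] Computable

/-! ### A weak type inequality for step functions -/

/-- A discrete maximal inequality: the number of cells that lie in a box on which the average of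
`F` exceeds `1` is at most `5^n ∑ F`. -/
theorem card_le_of_forall_mem_box {b : ℕ} (F : (Fin n → ℕ) → ℕ) (s : Finset (Fin n → ℕ))
    (hs : ∀ w ∈ s, ∃ v l, l ≤ b ∧ (∀ i, v i + l ≤ b) ∧ l ^ n < ∑ u ∈ box v l, F u ∧
      w ∈ box v l) :
    s.card ≤ 5 ^ n * ∑ u ∈ box 0 b, F u := by
  classical
  let t : Set ((Fin n → ℕ) × ℕ) :=
    {a | a.2 ≤ b ∧ (∀ i, a.1 i + a.2 ≤ b) ∧ a.2 ^ n < ∑ u ∈ box a.1 a.2, F u}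
  have htfin : t.Finite := by
    refine Set.Finite.subset ((box 0 (b + 1)) ×ˢ Finset.range (b + 1)).finite_toSet ?_
    rintro ⟨v, l⟩ ⟨h1, h2, -⟩
    have h2' : ∀ i, v i < b + 1 := fun i => by
      have : v i + l ≤ b := h2 i
      omega
    simpa [mem_box, Nat.lt_succ_iff.2 h1] using h2'
  -- Vitali: disjoint boxes such that each box of `t` meets a chosen one whose side is at least half
  -- as long.
  obtain ⟨u, hut, hdisj, hcov⟩ := Vitali.exists_disjoint_subfamily_covering_enlargement
    (fun a : (Fin n → ℕ) × ℕ => (↑(box a.1 a.2) : Set (Fin n → ℕ))) t (fun a => (a.2 : ℝ)) 2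
    (by norm_num) (fun _ _ => Nat.cast_nonneg _) b (fun a ha => Nat.cast_le.2 ha.1) (by
      rintro ⟨v, l⟩ ⟨-, -, h3⟩
      by_contra hne
      rw [Finset.coe_nonempty, Finset.not_nonempty_iff_eq_empty] at hne
      simp [hne] at h3)
  have hufin := htfin.subset hut
  -- A box of side at most `2 * a.2` that meets box `a` lies in its enlargement by `2 * a.2` on both
  -- sides, of side `5 * a.2`. Truncation at `0` is harmless.
  have hsub : s ⊆ hufin.toFinset.biUnion fun a =>
      Fintype.piFinset fun i => Finset.Ico (a.1 i - 2 * a.2) (a.1 i + 3 * a.2) := by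
    intro w hw
    obtain ⟨v, l, h1, h2, h3, h4⟩ := hs w hw
    obtain ⟨a, hau, ⟨y, hy1, hy2⟩, hle⟩ := hcov (v, l) ⟨h1, h2, h3⟩
    refine Finset.mem_biUnion.2 ⟨a, hufin.mem_toFinset.2 hau, ?_⟩
    refine Fintype.mem_piFinset.2 fun i => Finset.mem_Ico.2 ?_
    have h5 := mem_box.1 hy1 i
    have h6 := mem_box.1 hy2 i
    have h7 := mem_box.1 h4 i
    have h8 : l ≤ 2 * a.2 := by exact_mod_cast hle
    dsimp only at h5
    omega
  calc s.card ≤ ∑ a ∈ hufin.toFinset, (Fintype.piFinset fun i =>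
        Finset.Ico (a.1 i - 2 * a.2) (a.1 i + 3 * a.2)).card :=
        (Finset.card_le_card hsub).trans Finset.card_biUnion_le
    _ ≤ ∑ a ∈ hufin.toFinset, 5 ^ n * ∑ w ∈ box a.1 a.2, F w := by
        refine Finset.sum_le_sum fun a ha => ?_
        have h3 := (hut (hufin.mem_toFinset.1 ha)).2.2
        calc _ ≤ ∏ _i : Fin n, 5 * a.2 := by
              rw [Fintype.card_piFinset]
              exact Finset.prod_le_prod' fun i _ => by rw [Nat.card_Ico]; omega
          _ = 5 ^ n * a.2 ^ n := by simp [mul_pow]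
          _ ≤ _ := Nat.mul_le_mul_left _ h3.le
    _ = 5 ^ n * ∑ w ∈ hufin.toFinset.biUnion fun a => box a.1 a.2, F w := by
        rw [← Finset.mul_sum, Finset.sum_biUnion]
        intro a ha a' ha' hne
        have := hdisj (hufin.mem_toFinset.1 ha) (hufin.mem_toFinset.1 ha') hne
        exact Finset.disjoint_coe.1 this
    _ ≤ 5 ^ n * ∑ u ∈ box 0 b, F u := by
        refine Nat.mul_le_mul_left _ (Finset.sum_le_sum_of_subset ?_)
        refine Finset.biUnion_subset.2 fun a ha w hw => mem_box.2 fun i => ?_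
        have h1 := (hut (hufin.mem_toFinset.1 ha)).2.1 i
        have h2 := mem_box.1 hw i
        simp only [Pi.zero_apply]
        omega

/-- The predicate "the cell `w` of `[0,1]^n` lies in a box on which the average of `F`
exceeds `1`". -/
def heavy (N : ℕ) (F : (Fin n → ℕ) → ℕ) (w : Fin n → ℕ) : Bool :=
  decide (∃ l < 2 ^ N + 1, decide (∃ p < (2 ^ N) ^ n,
    (decide (∀ i, (decide (digits n (2 ^ N) p i + l ≤ 2 ^ N) &&
      (decide (digits n (2 ^ N) p i ≤ w i) &&
        decide (w i < digits n (2 ^ N) p i + l))) = true) &&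
    decide (l ^ n < ∑ p' ∈ Finset.range ((2 ^ N) ^ n),
      if decide (∀ i, (decide (digits n (2 ^ N) p i ≤ digits n (2 ^ N) p' i) &&
        decide (digits n (2 ^ N) p' i < digits n (2 ^ N) p i + l)) = true) then
        F (digits n (2 ^ N) p') else 0)) = true) = true)

@[fun_prop] theorem computable_heavy {α : Type*} [Primcodable α] {N : α → ℕ}
    {F : α → (Fin n → ℕ) → ℕ} {w : α → Fin n → ℕ} (hN : Computable N)
    (hF : Computable fun q : α × (Fin n → ℕ) => F q.1 q.2) (hw : Computable w) :
    Computable fun a => heavy (N a) (F a) (w a) := by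
  unfold heavy
  fun_prop

theorem sum_digits_mem_box {b l : ℕ} {v : Fin n → ℕ} (hv : ∀ i, v i + l ≤ b)
    (F : (Fin n → ℕ) → ℕ) :
    (∑ p ∈ Finset.range (b ^ n), if ∀ i, (decide (v i ≤ digits n b p i) &&
      decide (digits n b p i < v i + l)) = true then F (digits n b p) else 0) =
      ∑ u ∈ box v l, F u := by
  rw [sum_digits (fun u => if ∀ i, (decide (v i ≤ u i) &&
      decide (u i < v i + l)) = true then F u else 0)]
  simp only [decide_eq_true_eq, Bool.and_eq_true, ← mem_box]
  rw [← Finset.sum_filter]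
  congr 1
  ext u
  simp only [Finset.mem_filter, and_iff_right_iff_imp]
  intro hu
  refine mem_box.2 fun i => ?_
  have := mem_box.1 hu i
  have := hv i
  simp only [Pi.zero_apply]
  omega

theorem heavy_iff {N : ℕ} {F : (Fin n → ℕ) → ℕ} {w : Fin n → ℕ} :
    heavy N F w = true ↔ ∃ v l, l ≤ 2 ^ N ∧ (∀ i, v i + l ≤ 2 ^ N) ∧
      l ^ n < ∑ u ∈ box v l, F u ∧ w ∈ box v l := by
  simp only [heavy, decide_eq_true_eq, Bool.and_eq_true (decide (∀ i, _)),
    Bool.and_eq_true (decide (_ + _ ≤ _)), Bool.and_eq_true (decide (_ ≤ w _))]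
  constructor
  · rintro ⟨l, hl, p, -, h1, h2⟩
    refine ⟨_, l, Nat.lt_succ_iff.1 hl, fun i => (h1 i).1, ?_, mem_box.2 fun i => (h1 i).2⟩
    rwa [← sum_digits_mem_box fun i => (h1 i).1]
  · rintro ⟨v, l, hl, h1, h2, h3⟩
    have h4 : ∀ i, v i < 2 ^ N := fun i => by
      have := mem_box.1 h3 i
      have := h1 i
      omega
    obtain ⟨p, hp, rfl⟩ := exists_digits h4
    refine ⟨l, Nat.lt_succ_iff.2 hl, p, hp, fun i => ⟨h1 i, mem_box.1 h3 i⟩, ?_⟩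
    rwa [sum_digits_mem_box h1]

theorem volume_heavy_le (N : ℕ) (F : (Fin n → ℕ) → ℕ) :
    volume.real {x ∈ halfCube n | heavy N F (cellIndex N x) = true} ≤
      5 ^ n * ∫ x in halfCube n, (F (cellIndex N x) : ℝ) := by
  rw [volume_real_cellIndex (P := fun v => heavy N F v = true),
    setIntegral_cellIndex N fun v => (F v : ℝ), ← mul_div_assoc]
  gcongr
  have := card_le_of_forall_mem_box (b := 2 ^ N) F
    {u ∈ box 0 (2 ^ N) | heavy N F u = true} fun w hw => heavy_iff.1 (Finset.mem_filter.1 hw).2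
  exact_mod_cast this

/-! ### Subcubes and averages -/

theorem IsSubcube.bounds {a : Fin n → ℝ} {s : ℝ} (hs : 0 < s)
    (h : Icc a (fun i => a i + s) ⊆ unitCube n) (i : Fin n) : 0 ≤ a i ∧ a i + s ≤ 1 := by
  have hle : a ≤ fun i => a i + s := fun i => by simpa using hs.le
  exact ⟨(mem_unitCube.1 (h (left_mem_Icc.2 hle)) i).1,
    (mem_unitCube.1 (h (right_mem_Icc.2 hle)) i).2⟩

theorem volume_real_cube (a : Fin n → ℝ) {s : ℝ} (hs : 0 < s) :
    volume.real (Icc a fun i => a i + s) = s ^ n := by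
  rw [measureReal_def, Real.volume_Icc_pi_toReal fun i => by simpa using hs.le]
  simp

/-- Every subcube of `[0,1]^n` is contained in a box of cells of comparable size. -/
theorem exists_box_cover {a : Fin n → ℝ} {s : ℝ} (_ : 0 < s)
    (h : ∀ i, 0 ≤ a i ∧ a i + s ≤ 1) (N : ℕ) :
    ∃ (v : Fin n → ℕ) (l : ℕ), 0 < l ∧ l ≤ 2 ^ N ∧ (l : ℝ) ≤ ⌊s * 2 ^ N⌋₊ + 2 ∧ (∀ i, v i + l ≤ 2 ^ N) ∧
      ∀ x ∈ Icc a (fun i => a i + s), (∀ i, (v i : ℝ) ≤ x i * 2 ^ N ∧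
        x i * 2 ^ N ≤ v i + l) ∧ (x ∈ halfCube n → cellIndex N x ∈ box v l) := by
  have hM := pow_pos (two_pos (α := ℝ)) N
  -- An interval of length `s` meets at most `⌊s * 2^N⌋ + 2` cells. The cap `2^N`, and moving the
  -- corner back to at most `2^N - l`, keep the box inside the unit cube.
  set l := min (⌊s * 2 ^ N⌋₊ + 2) (2 ^ N) with hl
  have hlM : l ≤ 2 ^ N := min_le_right _ _
  refine ⟨fun i => min ⌊a i * 2 ^ N⌋₊ (2 ^ N - l), l, by positivity, hlM, ?_, fun i => ?_, ?_⟩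
  · have : ((l : ℕ) : ℝ) ≤ ((⌊s * 2 ^ N⌋₊ + 2 : ℕ) : ℝ) := Nat.cast_le.2 (min_le_left _ _)
    simpa using this
  · have : (fun i => min ⌊a i * 2 ^ N⌋₊ (2 ^ N - l)) i ≤ 2 ^ N - l := min_le_right ⌊a i * 2 ^ N⌋₊ (2 ^ N - l)
    omega
  · intro x hx
    have hva : ∀ i, ((min ⌊a i * 2 ^ N⌋₊ (2 ^ N - l) : ℕ) : ℝ) ≤ a i * 2 ^ N := fun i =>
      (Nat.cast_le.2 (min_le_left _ _)).trans
        (Nat.floor_le (mul_nonneg (h i).1 hM.le))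
    have hlow : ∀ i, ((min ⌊a i * 2 ^ N⌋₊ (2 ^ N - l) : ℕ) : ℝ) ≤ x i * 2 ^ N := fun i =>
      (hva i).trans (mul_le_mul_of_nonneg_right (hx.1 i) hM.le)
    -- In each direction the box either ends beyond `x` or reaches the far face of the unit cube.
    have hup : ∀ i, x i * 2 ^ N < (min ⌊a i * 2 ^ N⌋₊ (2 ^ N - l) : ℕ) + l ∨
        min ⌊a i * 2 ^ N⌋₊ (2 ^ N - l) + l = 2 ^ N := fun i => by
      rcases le_total (2 ^ N - l) ⌊a i * 2 ^ N⌋₊ with hc | hc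
      · right
        rw [min_eq_right hc]
        omega
      rcases le_total (⌊s * 2 ^ N⌋₊ + 2) (2 ^ N) with hd | hd
      · left
        rw [min_eq_left hc, hl, min_eq_left hd]
        have h1 := Nat.lt_floor_add_one (a i * 2 ^ N)
        have h2 := Nat.lt_floor_add_one (s * 2 ^ N)
        have h3 := mul_le_mul_of_nonneg_right (hx.2 i) hM.le
        push_cast
        linarith
      · right
        rw [hl, min_eq_right hd]
        omega
    refine ⟨fun i => ⟨hlow i, ?_⟩, fun hxh => mem_box.2 fun i => ⟨?_, ?_⟩⟩
    · rcases hup i with hc | hc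
      · exact hc.le
      · have hc' : ((min ⌊a i * 2 ^ N⌋₊ (2 ^ N - l) : ℕ) : ℝ) + l = 2 ^ N := by exact_mod_cast hc
        rw [hc']
        nlinarith [hx.2 i, (h i).2]
    · exact Nat.le_floor (hlow i)
    · have hx0 := mem_halfCube.1 hxh i
      rw [cellIndex, Nat.floor_lt (mul_nonneg hx0.1 hM.le)]
      push_cast
      rcases hup i with hc | hc
      · simpa using hc
      · have hc' : ((min ⌊a i * 2 ^ N⌋₊ (2 ^ N - l) : ℕ) : ℝ) + l = 2 ^ N := by exact_mod_cast hc
        push_cast at hc'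
        rw [hc']
        nlinarith

/-- A point of a closed box of cells lies in the closure of one of the cells. -/
theorem exists_cell_mem {N l : ℕ} (hl : 0 < l) {v : Fin n → ℕ} {z : Fin n → ℝ}
    (hz : ∀ i, (v i : ℝ) ≤ z i * 2 ^ N ∧ z i * 2 ^ N ≤ v i + l) :
    ∃ w ∈ box v l, ∀ i, (w i : ℝ) ≤ z i * 2 ^ N ∧ z i * 2 ^ N ≤ w i + 1 := by
  have h : ∀ i, ∃ w : ℕ, (v i ≤ w ∧ w < v i + l) ∧
      (w : ℝ) ≤ z i * 2 ^ N ∧ z i * 2 ^ N ≤ w + 1 := fun i => by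
    obtain ⟨h1, h2⟩ := hz i
    have h0 : 0 ≤ z i * 2 ^ N := (Nat.cast_nonneg _).trans h1
    rcases h2.lt_or_eq with h3 | h3
    · refine ⟨⌊z i * 2 ^ N⌋₊, ⟨Nat.le_floor h1, ?_⟩, Nat.floor_le h0,
        (Nat.lt_floor_add_one _).le⟩
      rw [Nat.floor_lt h0]
      exact_mod_cast h3
    -- On the far face the coordinate belongs to the closure of the last cell only.
    · refine ⟨v i + l - 1, ⟨by omega, by omega⟩, ?_, ?_⟩ <;>
        rw [h3, Nat.cast_sub (by omega)] <;> push_cast <;> linarith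
  choose w hw using h
  exact ⟨w, mem_box.2 fun i => (hw i).1, fun i => (hw i).2⟩

/-- If no heavy cell touches `z`, then the integrals of the step function `F` over cubes
containing `z` are small. -/
theorem setIntegral_le_of_not_heavy {N : ℕ} {F : (Fin n → ℕ) → ℕ} {z : Fin n → ℝ}
    (hz : ∀ w ∈ box 0 (2 ^ N), heavy N F w = true →
      ¬ ∀ i, (w i : ℝ) ≤ z i * 2 ^ N ∧ z i * 2 ^ N ≤ w i + 1)
    {a : Fin n → ℝ} {s : ℝ} (hs : 0 < s) (h : Icc a (fun i => a i + s) ⊆ unitCube n)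
    (hza : z ∈ Icc a fun i => a i + s) :
    ∫ x in Icc a (fun i => a i + s) ∩ halfCube n, (F (cellIndex N x) : ℝ) ≤ 3 ^ n * s ^ n := by
  have hM := pow_pos (two_pos (α := ℝ)) N
  obtain ⟨v, l, hl0, hlM, hl, hvl, hx⟩ := exists_box_cover hs (IsSubcube.bounds hs h) N
  obtain ⟨w, hw, hwz⟩ := exists_cell_mem hl0 (hx z hza).1
  -- The covering box contains a cell touching `z`; a larger sum would make that cell heavy.
  have hsum : ∑ u ∈ box v l, F u ≤ l ^ n := by
    by_contra! hlt
    refine hz w (mem_box.2 fun i => ?_) (heavy_iff.2 ⟨v, l, hlM, hvl, hlt, hw⟩) hwz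
    have := mem_box.1 hw i
    have := hvl i
    simp only [Pi.zero_apply]
    omega
  have hmeas : MeasurableSet (Icc a (fun i => a i + s) ∩ halfCube n) :=
    measurableSet_Icc.inter measurableSet_halfCube
  -- If the cube is smaller than a cell, then `l ≤ 2` and `F` is bounded pointwise on the box.
  -- Otherwise `l ≤ 3 * s * 2^N`, and the integral over the whole box suffices.
  rcases lt_or_ge (s * 2 ^ N) 1 with hsN | hsN
  · have hl2 : l ≤ 2 := by
      rw [Nat.floor_eq_zero.2 hsN] at hl
      exact_mod_cast (by simpa using hl : (l : ℝ) ≤ 2)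
    have hF : ∀ u ∈ box v l, (F u : ℝ) ≤ 3 ^ n := fun u hu => by
      have h1 : F u ≤ 3 ^ n :=
        calc F u ≤ ∑ u ∈ box v l, F u :=
              Finset.single_le_sum (f := F) (fun _ _ => Nat.zero_le _) hu
          _ ≤ l ^ n := hsum
          _ ≤ 3 ^ n := Nat.pow_le_pow_left (by omega) n
      exact_mod_cast h1
    have hfin : volume (Icc a (fun i => a i + s) ∩ halfCube n) ≠ ⊤ :=
      volume_ne_top_of_subset (inter_subset_left.trans h)
    calc _ ≤ ∫ x in Icc a (fun i => a i + s) ∩ halfCube n, (3 : ℝ) ^ n := by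
          refine setIntegral_mono_on ((integrableOn_cellIndex N fun u => (F u : ℝ)).mono_set
            inter_subset_right) (integrableOn_const hfin) hmeas fun x hxm => ?_
          exact hF _ ((hx x hxm.1).2 hxm.2)
      _ = volume.real (Icc a (fun i => a i + s) ∩ halfCube n) * 3 ^ n := by
          rw [setIntegral_const, smul_eq_mul]
      _ ≤ s ^ n * 3 ^ n := by
          rw [← volume_real_cube a hs]
          gcongr
          · exact volume_ne_top_of_subset h
          · exact inter_subset_left
      _ = _ := mul_comm _ _
  · have hl3 : (l : ℝ) ≤ 3 * (s * 2 ^ N) := by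
      have := Nat.floor_le (by positivity : 0 ≤ s * 2 ^ N)
      linarith
    let G : (Fin n → ℕ) → ℝ := fun u => if u ∈ box v l then (F u : ℝ) else 0
    have hG : ∀ u, 0 ≤ G u := fun u => by
      simp only [G]
      split_ifs <;> simp
    calc _ = ∫ x in Icc a (fun i => a i + s) ∩ halfCube n, G (cellIndex N x) := by
          refine setIntegral_congr_fun hmeas fun x hxm => ?_
          simp only [G, if_pos ((hx x hxm.1).2 hxm.2)]
      _ ≤ ∫ x in halfCube n, G (cellIndex N x) :=
          setIntegral_mono_set (integrableOn_cellIndex N G)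
            (.of_forall fun x => hG _) (LE.le.eventuallyLE inter_subset_right)
      _ = ((∑ u ∈ box v l, F u : ℕ) : ℝ) / ((2 : ℝ) ^ N) ^ n := by
          rw [setIntegral_cellIndex, ← Finset.sum_filter]
          congr 1
          push_cast
          refine Finset.sum_congr ?_ fun _ _ => rfl
          ext u
          simp only [Finset.mem_filter, and_iff_right_iff_imp]
          intro hu
          refine mem_box.2 fun i => ?_
          have := mem_box.1 hu i
          have := hvl i
          simp only [Pi.zero_apply]
          omega
      _ ≤ (3 * (s * 2 ^ N)) ^ n / ((2 : ℝ) ^ N) ^ n := by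
          gcongr
          calc ((∑ u ∈ box v l, F u : ℕ) : ℝ) ≤ (l : ℝ) ^ n := by exact_mod_cast hsum
            _ ≤ _ := by gcongr
      _ = 3 ^ n * s ^ n := by
          rw [mul_pow, mul_pow]
          field_simp

end Schnorr

namespace Schnorr

open MeasureTheory Set

variable {n : ℕ}

attribute [local irreducible] Computable

/-! ### Schnorr random points are weak Lebesgue points -/

/-- `⌊2^k |val p - val p'|⌋`. -/
def scaledDist (k : ℕ) (p p' : RatCode) : ℕ :=
  2 ^ k * ((p.1 * (p'.2.2 + 1) + p'.2.1 * (p.2.2 + 1) -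
      (p.2.1 * (p'.2.2 + 1) + p'.1 * (p.2.2 + 1))) +
    (p.2.1 * (p'.2.2 + 1) + p'.1 * (p.2.2 + 1) -
      (p.1 * (p'.2.2 + 1) + p'.2.1 * (p.2.2 + 1)))) / ((p.2.2 + 1) * (p'.2.2 + 1))

@[fun_prop] theorem computable_scaledDist {α : Type*} [Primcodable α] {k : α → ℕ}
    {p p' : α → RatCode} (hk : Computable k) (hp : Computable p) (hp' : Computable p') :
    Computable fun a => scaledDist (k a) (p a) (p' a) := by
  unfold scaledDist
  fun_prop

theorem cast_sub_add_sub (x y : ℕ) : (((x - y) + (y - x) : ℕ) : ℝ) = |(x : ℝ) - y| := by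
  rcases le_total x y with h | h
  · rw [Nat.sub_eq_zero_of_le h, zero_add, Nat.cast_sub h, abs_sub_comm, abs_of_nonneg]
    exact sub_nonneg.2 (Nat.cast_le.2 h)
  · rw [Nat.sub_eq_zero_of_le h, add_zero, Nat.cast_sub h, abs_of_nonneg]
    exact sub_nonneg.2 (Nat.cast_le.2 h)

theorem scaledDist_eq (k : ℕ) (p p' : RatCode) :
    scaledDist k p p' = ⌊2 ^ k * |((RatCode.val p : ℚ) : ℝ) - (RatCode.val p' : ℚ)|⌋₊ := by
  rw [scaledDist, ← Nat.floor_div_eq_div (K := ℝ)]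
  congr 1
  rw [Nat.cast_mul, cast_sub_add_sub, RatCode.cast_val, RatCode.cast_val]
  have h1 : (0 : ℝ) < p.2.2 + 1 := by positivity
  have h2 : (0 : ℝ) < p'.2.2 + 1 := by positivity
  rw [div_sub_div _ _ h1.ne' h2.ne', abs_div, abs_of_pos (mul_pos h1 h2)]
  push_cast
  rw [mul_div_assoc]
  congr 3
  ring

theorem UniformlyComputableFunctions.continuousOn {h : ℕ → (Fin n → ℝ) → ℝ}
    (hh : UniformlyComputableFunctions h) (k : ℕ) : ContinuousOn (h k) (unitCube n) := by
  obtain ⟨r, -, hr⟩ := hh.modulus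
  refine Metric.continuousOn_iff.2 fun x hx ε hε => ?_
  obtain ⟨m, hm⟩ := exists_pow_lt_of_lt_one hε (by norm_num : (1 / 2 : ℝ) < 1)
  exact ⟨(1 / 2) ^ r k m, by positivity, fun y hy hxy => (hr k m y hy x hx hxy).trans hm⟩

theorem UniformlyComputableFunctions.integrableOn {h : ℕ → (Fin n → ℝ) → ℝ}
    (hh : UniformlyComputableFunctions h) (k : ℕ) : IntegrableOn (h k) (unitCube n) :=
  (hh.continuousOn k).integrableOn_compact isCompact_Icc

/-- The name of the least corner of a cell. -/
def cornerCode (N : ℕ) (w : Fin n → ℕ) : Fin n → RatCode := fun i => (w i, 0, 2 ^ N - 1)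

@[fun_prop] theorem computable_cornerCode {α : Type*} [Primcodable α] {N : α → ℕ}
    {w : α → Fin n → ℕ} (hN : Computable N) (hw : Computable w) :
    Computable fun a => cornerCode (N a) (w a) := by
  unfold cornerCode
  fun_prop

theorem ratPoint_cornerCode (N : ℕ) (w : Fin n → ℕ) (i : Fin n) :
    ratPoint (cornerCode N w) i = w i / 2 ^ N := by
  rw [ratPoint, cornerCode, RatCode.cast_val_pred _ _ _ (by positivity)]
  simp

theorem ratPoint_cornerCode_mem {N : ℕ} {x : Fin n → ℝ} (hx : x ∈ halfCube n) :
    ratPoint (cornerCode N (cellIndex N x)) ∈ unitCube n ∧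
      dist x (ratPoint (cornerCode N (cellIndex N x))) < (1 / 2) ^ N := by
  have hp := pow_pos (two_pos (α := ℝ)) N
  constructor
  · refine mem_unitCube.2 fun i => ?_
    rw [ratPoint_cornerCode]
    refine ⟨by positivity, (div_le_one hp).2 ?_⟩
    exact_mod_cast (cellIndex_lt hx i).le
  · refine (dist_pi_lt_iff (by positivity)).2 fun i => ?_
    obtain ⟨h1, h2⟩ := cell_index_bounds (N := N) (halfCube_subset_unitCube hx) i
    rw [ratPoint_cornerCode, Real.dist_eq, one_div_pow, abs_sub_lt_iff, sub_lt_iff_lt_add,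
      sub_lt_iff_lt_add, ← add_div, lt_div_iff₀ hp, div_lt_iff₀ hp, add_mul, one_div,
      inv_mul_cancel₀ hp.ne']
    constructor <;> linarith

/-- The differences of consecutive members of a uniformly computable sequence are approximated by
computable step functions with values in `2^(-k) ℕ`. -/
theorem exists_step_approximation {h : ℕ → (Fin n → ℝ) → ℝ}
    (hh : UniformlyComputableFunctions h) :
    ∃ (N : ℕ → ℕ) (F : ℕ → (Fin n → ℕ) → ℕ), Computable N ∧
      (Computable fun q : ℕ × (Fin n → ℕ) => F q.1 q.2) ∧
      ∀ k, ∀ x ∈ halfCube n,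
        (F k (cellIndex (N k) x) : ℝ) ≤ 2 ^ k * |h (2 * (k + 1)) x - h (2 * k) x| ∧
        2 ^ k * |h (2 * (k + 1)) x - h (2 * k) x| ≤ F k (cellIndex (N k) x) + 3 := by
  obtain ⟨q, hq, hqv⟩ := hh.values
  obtain ⟨r, hr, hrv⟩ := hh.modulus
  have hq' : Computable fun p : (ℕ × (Fin n → RatCode)) × ℕ => q p.1 p.2 := hq
  have hr' : Computable fun p : ℕ × ℕ => r p.1 p.2 := hr
  -- The sum dominates both moduli. At precision `k + 3` the four errors, two from moving to the
  -- corner and two from rational approximation, total `1/2` after scaling by `2^k`.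
  let N : ℕ → ℕ := fun k => r (2 * (k + 1)) (k + 3) + r (2 * k) (k + 3)
  have hN : Computable N := by
    simp only [N]
    fun_prop
  -- Subtracting `1` turns a floor with error `1/2` into a lower bound; the loss stays below `3`.
  refine ⟨N, fun k w => scaledDist k (q (2 * (k + 1), cornerCode (N k) w) (k + 3))
    (q (2 * k, cornerCode (N k) w) (k + 3)) - 1, hN, by fun_prop, fun k x hx => ?_⟩
  obtain ⟨hc, hd⟩ := ratPoint_cornerCode_mem (N := N k) hx
  have hxu := halfCube_subset_unitCube hx
  beta_reduce
  rw [scaledDist_eq]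
  set c := cornerCode (N k) (cellIndex (N k) x)
  have hd1 : dist x (ratPoint c) < (1 / 2) ^ r (2 * (k + 1)) (k + 3) :=
    hd.trans_le (pow_le_pow_of_le_one (by norm_num) (by norm_num) (Nat.le_add_right _ _))
  have hd2 : dist x (ratPoint c) < (1 / 2) ^ r (2 * k) (k + 3) :=
    hd.trans_le (pow_le_pow_of_le_one (by norm_num) (by norm_num) (Nat.le_add_left _ _))
  have e1 := hrv _ _ x hxu _ hc hd1
  have e2 := hrv _ _ x hxu _ hc hd2
  have e3 := hqv (2 * (k + 1), c) hc (k + 3)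
  have e4 := hqv (2 * k, c) hc (k + 3)
  dsimp only at e3 e4
  generalize ((RatCode.val (q (2 * (k + 1), c) (k + 3)) : ℚ) : ℝ) = ra at *
  generalize ((RatCode.val (q (2 * k, c) (k + 3)) : ℚ) : ℝ) = rb at *
  have hk : (2 : ℝ) ^ k * (1 / 2) ^ (k + 3) = 1 / 8 := by
    rw [pow_add, ← mul_assoc, ← mul_pow]
    norm_num
  have hclose : |2 ^ k * |h (2 * (k + 1)) x - h (2 * k) x| - (2 ^ k * |ra - rb|)| ≤ 1 / 2 := by
    rw [← mul_sub, abs_mul, abs_of_pos (by positivity : (0 : ℝ) < 2 ^ k)]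
    calc _ ≤ (2 : ℝ) ^ k * |(h (2 * (k + 1)) x - h (2 * k) x) - (ra - rb)| := 
          mul_le_mul_of_nonneg_left (abs_abs_sub_abs_le _ _) (by positivity)
      _ ≤ 2 ^ k * (4 * (1 / 2) ^ (k + 3)) := by
          gcongr
          rw [abs_lt] at e1 e2
          rw [abs_le] at e3 e4 ⊢
          constructor <;> linarith [e1.1, e1.2, e2.1, e2.2, e3.1, e3.2, e4.1, e4.2]
      _ = 1 / 2 := by rw [mul_left_comm, hk]; norm_num
  have hpos : 0 ≤ 2 ^ k * |ra - rb| := by positivity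
  have hpos' : 0 ≤ 2 ^ k * |h (2 * (k + 1)) x - h (2 * k) x| := by positivity
  have hf1 := Nat.floor_le hpos
  have hf2 := Nat.lt_floor_add_one (2 ^ k * |ra - rb|)
  rw [abs_le] at hclose
  generalize ⌊2 ^ k * |ra - rb|⌋₊ = m at *
  rcases Nat.eq_zero_or_pos m with rfl | hm
  · simp only [Nat.zero_sub, Nat.cast_zero] at *
    constructor <;> linarith
  · rw [Nat.cast_sub hm, Nat.cast_one]
    constructor <;> linarith

/-- A limit criterion: averages that are eventually close to some numbers converge. -/
theorem exists_limit {ι : Type*} (S : ℝ → Set ι) (hS : Monotone S) (A : ι → ℝ)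
    (h : ∀ ε > 0, ∃ δ > 0, ∃ y : ℝ, ∀ Q ∈ S δ, |A Q - y| ≤ ε) :
    ∃ L : ℝ, ∀ ε > 0, ∃ δ > 0, ∀ Q ∈ S δ, |A Q - L| < ε := by
  by_cases hne : ∃ δ > 0, S δ = ∅
  · obtain ⟨δ, hδ, he⟩ := hne
    -- The condition is vacuous here, so any value serves as the limit.
    exact ⟨0, fun ε _ => ⟨δ, hδ, by simp [he]⟩⟩
  push Not at hne
  have : Nonempty ι := ⟨(hne 1 one_pos).some⟩
  choose! q hq using hne
  have hc : CauchySeq fun m : ℕ => A (q (1 / (m + 1))) := by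
    refine Metric.cauchySeq_iff'.2 fun ε hε => ?_
    obtain ⟨δ, hδ, y, hy⟩ := h (ε / 3) (by positivity)
    obtain ⟨m, hm⟩ := exists_nat_one_div_lt hδ
    refine ⟨m, fun m' hm' => ?_⟩
    have key : ∀ m' ≥ m, q (1 / ((m' : ℝ) + 1)) ∈ S δ := fun m' hm' =>
      hS ((Nat.one_div_le_one_div hm').trans hm.le) (hq _ (by positivity))
    have h1 := abs_le.1 (hy _ (key m' hm'))
    have h2 := abs_le.1 (hy _ (key m le_rfl))
    rw [Real.dist_eq, abs_lt]
    constructor <;> linarith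
  obtain ⟨L, hL⟩ := cauchySeq_tendsto_of_complete hc
  refine ⟨L, fun ε hε => ?_⟩
  obtain ⟨δ, hδ, y, hy⟩ := h (ε / 4) (by positivity)
  refine ⟨δ, hδ, fun Q hQ => ?_⟩
  obtain ⟨m, hm⟩ := exists_nat_one_div_lt hδ
  obtain ⟨M, hM⟩ := Metric.tendsto_atTop.1 hL (ε / 4) (by positivity)
  have hmem : q (1 / (((max m M : ℕ) : ℝ) + 1)) ∈ S δ :=
    hS ((Nat.one_div_le_one_div (le_max_left m M)).trans hm.le) (hq _ (by positivity))
  have h1 := abs_le.1 (hy _ hmem)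
  have h2 := abs_lt.1 (hM _ (le_max_right m M))
  have h3 := abs_le.1 (hy _ hQ)
  rw [abs_lt]
  constructor <;> linarith

theorem setIntegral_unitCube_eq (f : (Fin n → ℝ) → ℝ) :
    ∫ x in unitCube n, f x = ∫ x in halfCube n, f x :=
  (setIntegral_congr_set halfCube_ae_eq).symm

/-- Only even indices are used, so the differences decay like `4^(-k)`: one factor `2^(-k)` is spent
on making the heavy sets summable, the other on making the bounds over each cube summable. -/
theorem IsSchnorrRandom.isWeakLebesguePoint {z : Fin n → ℝ} (hz : IsSchnorrRandom z)
    (hzc : z ∈ unitCube n) {g : (Fin n → ℝ) → ℝ} (hg : IsL1Computable g) :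
    IsWeakLebesguePoint g z := by
  obtain ⟨hgi, h, hh, hgh⟩ := hg
  obtain ⟨N, F, hN, hF, hNF⟩ := exists_step_approximation hh
  have hhi := hh.integrableOn
  have hdiff : ∀ i j, IntegrableOn (fun x => |h i x - h j x|) (unitCube n) := fun i j =>
    ((hhi i).sub (hhi j)).abs
  have hgdiff : ∀ i, IntegrableOn (fun x => |g x - h i x|) (unitCube n) := fun i =>
    (hgi.sub (hhi i)).abs
  have hL1 : ∀ k, ∫ x in unitCube n, |h (2 * (k + 1)) x - h (2 * k) x| ≤
      2 * ((1 / 2) ^ k * (1 / 2) ^ k) := fun k => by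
    calc _ ≤ ∫ x in unitCube n, (|g x - h (2 * (k + 1)) x| + |g x - h (2 * k) x|) := by
          refine setIntegral_mono (hdiff _ _) ((hgdiff _).add (hgdiff _)) fun x => ?_
          have := abs_sub_le (h (2 * (k + 1)) x) (g x) (h (2 * k) x)
          rwa [abs_sub_comm _ (g x)] at this
      _ = (∫ x in unitCube n, |g x - h (2 * (k + 1)) x|) +
            ∫ x in unitCube n, |g x - h (2 * k) x| := integral_add (hgdiff _) (hgdiff _)
      _ ≤ (1 / 2) ^ (2 * (k + 1)) + (1 / 2) ^ (2 * k) := add_le_add (hgh _).le (hgh _).le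
      _ ≤ (1 / 2) ^ (2 * k) + (1 / 2) ^ (2 * k) := by
          gcongr ?_ + _
          exact pow_le_pow_of_le_one (by norm_num) (by norm_num) (by omega)
      _ = _ := by rw [← pow_add]; ring_nf
  have hvol : ∀ k, volume.real {x ∈ halfCube n | heavy (N k) (F k) (cellIndex (N k) x) = true} ≤
      ((2 * 5 ^ n : ℕ) : ℝ) * (1 / 2) ^ k := fun k => by
    refine (volume_heavy_le _ _).trans ?_
    calc (5 : ℝ) ^ n * ∫ x in halfCube n, (F k (cellIndex (N k) x) : ℝ)
        ≤ 5 ^ n * ∫ x in halfCube n, 2 ^ k * |h (2 * (k + 1)) x - h (2 * k) x| := by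
          refine mul_le_mul_of_nonneg_left ?_ (by positivity)
          exact setIntegral_mono_on (integrableOn_cellIndex _ fun u => (F k u : ℝ))
            (((hdiff _ _).mono_set halfCube_subset_unitCube).const_mul _)
            measurableSet_halfCube fun x hx => (hNF k x hx).1
      _ ≤ 5 ^ n * (2 ^ k * (2 * ((1 / 2) ^ k * (1 / 2) ^ k))) := by
          rw [integral_const_mul, ← setIntegral_unitCube_eq]
          gcongr
          exact hL1 k
      _ = ((2 * 5 ^ n : ℕ) : ℝ) * (1 / 2) ^ k * (2 ^ k * (1 / 2) ^ k) := by
          push_cast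
          ring
      _ = _ := by
          rw [← mul_pow]
          norm_num
  obtain ⟨K, hK⟩ := hz.eventually_notMem hzc hN
    (P := fun k w => heavy (N k) (F k) w) (by fun_prop) hvol
  -- the integrals of consecutive differences over a cube containing `z`
  have hstep : ∀ k ≥ K, ∀ (a : Fin n → ℝ) (s : ℝ), 0 < s →
      Icc a (fun i => a i + s) ⊆ unitCube n → z ∈ Icc a (fun i => a i + s) →
      ∫ x in Icc a (fun i => a i + s), |h (2 * (k + 1)) x - h (2 * k) x| ≤
        (3 ^ n + 3) * s ^ n * (1 / 2) ^ k := by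
    intro k hk a s hs hQ hzQ
    have h1 := setIntegral_le_of_not_heavy (hK k hk) hs hQ hzQ
    set Q := Icc a fun i => a i + s
    have hae : (Q ∩ halfCube n : Set (Fin n → ℝ)) =ᵐ[volume] Q := by
      have : (Q ∩ halfCube n : Set (Fin n → ℝ)) =ᵐ[volume] (Q ∩ unitCube n : Set (Fin n → ℝ)) :=
        (Filter.EventuallyEq.refl _ _).inter halfCube_ae_eq
      rwa [inter_eq_left.2 hQ] at this
    have hfin : volume (Q ∩ halfCube n) ≠ ⊤ := volume_ne_top_of_subset (inter_subset_left.trans hQ)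
    have hFi := (integrableOn_cellIndex (N k) fun u => (F k u : ℝ)).mono_set
      (inter_subset_right : Q ∩ halfCube n ⊆ _)
    have h2 : 2 ^ k * ∫ x in Q, |h (2 * (k + 1)) x - h (2 * k) x| ≤ (3 ^ n + 3) * s ^ n := by
      rw [← setIntegral_congr_set hae, ← integral_const_mul]
      calc _ ≤ ∫ x in Q ∩ halfCube n, ((F k (cellIndex (N k) x) : ℝ) + 3) :=
            setIntegral_mono_on
              (((hdiff _ _).mono_set (inter_subset_left.trans hQ)).const_mul _)
              (hFi.add (integrableOn_const hfin))
              (measurableSet_Icc.inter measurableSet_halfCube)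
              fun x hx => (hNF k x hx.2).2
        _ = (∫ x in Q ∩ halfCube n, (F k (cellIndex (N k) x) : ℝ)) +
              volume.real (Q ∩ halfCube n) * 3 := by
            rw [integral_add hFi (integrableOn_const hfin), setIntegral_const, smul_eq_mul]
        _ ≤ 3 ^ n * s ^ n + s ^ n * 3 := by
            rw [measureReal_congr hae, volume_real_cube a hs]
            gcongr
        _ = _ := by ring
    calc _ = (2 ^ k * ∫ x in Q, |h (2 * (k + 1)) x - h (2 * k) x|) * (1 / 2) ^ k := by
          rw [mul_right_comm, ← mul_pow]
          norm_num
      _ ≤ _ := by gcongr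
  have htail : ∀ k ≥ K, ∀ (a : Fin n → ℝ) (s : ℝ), 0 < s →
      Icc a (fun i => a i + s) ⊆ unitCube n → z ∈ Icc a (fun i => a i + s) →
      ∫ x in Icc a (fun i => a i + s), |g x - h (2 * k) x| ≤
        2 * ((3 ^ n + 3) * s ^ n) * (1 / 2) ^ k := by
    intro k hk a s hs hQ hzQ
    -- Telescoping: the factor `2 - 2 * (1/2)^j` is the partial geometric sum. For a fixed cube the
    -- remaining integral tends to `0` with `j`.
    have hfinite : ∀ j, ∫ x in Icc a (fun i => a i + s), |g x - h (2 * k) x| ≤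
        (∫ x in Icc a (fun i => a i + s), |g x - h (2 * (k + j)) x|) +
          (3 ^ n + 3) * s ^ n * (1 / 2) ^ k * (2 - 2 * (1 / 2) ^ j) := by
      intro j
      induction j with
      | zero => simp
      | succ j ih =>
        have h1 := hstep (k + j) (by omega) a s hs hQ hzQ
        have h2 : ∫ x in Icc a (fun i => a i + s), |g x - h (2 * (k + j)) x| ≤
            (∫ x in Icc a (fun i => a i + s), |g x - h (2 * (k + j + 1)) x|) +
            ∫ x in Icc a (fun i => a i + s), |h (2 * (k + j + 1)) x - h (2 * (k + j)) x| := by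
          rw [← integral_add ((hgdiff _).mono_set hQ) ((hdiff _ _).mono_set hQ)]
          exact setIntegral_mono ((hgdiff _).mono_set hQ)
            (((hgdiff _).mono_set hQ).add ((hdiff _ _).mono_set hQ))
            fun x => abs_sub_le _ _ _
        rw [pow_add] at h1
        rw [← add_assoc k j 1, pow_succ (1 / 2 : ℝ) j]
        linarith
    have hlim : Filter.Tendsto (fun j : ℕ => (1 / 2 : ℝ) ^ j +
        2 * ((3 ^ n + 3) * s ^ n) * (1 / 2) ^ k) Filter.atTop
        (nhds (0 + 2 * ((3 ^ n + 3) * s ^ n) * (1 / 2) ^ k)) :=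
      (tendsto_pow_atTop_nhds_zero_of_lt_one (by norm_num) (by norm_num)).add_const _
    rw [zero_add] at hlim
    refine ge_of_tendsto' hlim fun j => (hfinite j).trans ?_
    have h1 : ∫ x in Icc a (fun i => a i + s), |g x - h (2 * (k + j)) x| ≤ (1 / 2) ^ j :=
      calc _ ≤ ∫ x in unitCube n, |g x - h (2 * (k + j)) x| :=
            setIntegral_mono_set (hgdiff _) (.of_forall fun x => abs_nonneg _)
              (LE.le.eventuallyLE hQ)
        _ ≤ (1 / 2) ^ (2 * (k + j)) := (hgh _).le
        _ ≤ _ := pow_le_pow_of_le_one (by norm_num) (by norm_num) (by omega)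
    have h2 : 0 ≤ (3 ^ n + 3) * s ^ n * (1 / 2 : ℝ) ^ k * (2 * (1 / 2) ^ j) := by positivity
    linarith
  obtain ⟨L, hL⟩ := exists_limit
    (fun δ => {Q : Set (Fin n → ℝ) | IsSubcube Q ∧ z ∈ Q ∧ volume.real Q < δ})
    (fun δ δ' hδ Q hQ => ⟨hQ.1, hQ.2.1, hQ.2.2.trans_le hδ⟩)
    (fun Q => (volume.real Q)⁻¹ * ∫ x in Q, g x) (by
    intro ε hε
    obtain ⟨k, hkK, hk⟩ : ∃ k ≥ K, 2 * (3 ^ n + 3) * (1 / 2 : ℝ) ^ k ≤ ε / 2 := by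
      obtain ⟨m, hm⟩ := exists_pow_lt_of_lt_one
        (by positivity : 0 < ε / 2 / (2 * (3 ^ n + 3))) (by norm_num : (1 / 2 : ℝ) < 1)
      refine ⟨max K m, le_max_left _ _, ?_⟩
      rw [← le_div_iff₀' (by positivity)]
      exact (pow_le_pow_of_le_one (by norm_num) (by norm_num) (le_max_right _ _)).trans hm.le
    obtain ⟨ρ, hρ, hcont⟩ := Metric.continuousOn_iff.1 (hh.continuousOn (2 * k)) z hzc (ε / 2)
      (by positivity)
    -- Volume below `ρ^n` forces side below `ρ`.
    refine ⟨ρ ^ n, by positivity, h (2 * k) z, ?_⟩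
    rintro Q ⟨⟨hQ, a, s, hs, rfl⟩, hzQ, hsmall⟩
    rw [volume_real_cube a hs] at hsmall ⊢
    have hsρ : s < ρ := lt_of_pow_lt_pow_left₀ n hρ.le hsmall
    have hv : volume.real (Icc a fun i => a i + s) = s ^ n := volume_real_cube a hs
    have hfin : volume (Icc a fun i => a i + s) ≠ ⊤ := volume_ne_top_of_subset hQ
    have hgQ := hgi.mono_set hQ
    have hpt : ∀ x ∈ Icc a (fun i => a i + s), |g x - h (2 * k) z| ≤
        |g x - h (2 * k) x| + ε / 2 := fun x hx => by
      have hd : dist x z < ρ := (dist_pi_lt_iff hρ).2 fun i => by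
        rw [Real.dist_eq, abs_lt]
        have h1 := hx.1 i
        have h2 := hx.2 i
        have h3 := hzQ.1 i
        have h4 := hzQ.2 i
        dsimp only at h2 h4
        constructor <;> linarith
      have h1 := hcont x (hQ hx) hd
      rw [Real.dist_eq] at h1
      linarith [abs_sub_le (g x) (h (2 * k) x) (h (2 * k) z)]
    have hcalc : |(∫ x in Icc a fun i => a i + s, g x) - s ^ n * h (2 * k) z| ≤ s ^ n * ε := by
      calc _ = |∫ x in Icc a fun i => a i + s, (g x - h (2 * k) z)| := by
            rw [integral_sub hgQ (integrableOn_const hfin), setIntegral_const, hv, smul_eq_mul]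
        _ ≤ ∫ x in Icc a fun i => a i + s, |g x - h (2 * k) z| := abs_integral_le_integral_abs
        _ ≤ ∫ x in Icc a fun i => a i + s, (|g x - h (2 * k) x| + ε / 2) :=
            setIntegral_mono_on (hgQ.sub (integrableOn_const hfin)).abs
              (((hgdiff _).mono_set hQ).add (integrableOn_const hfin)) measurableSet_Icc hpt
        _ = (∫ x in Icc a fun i => a i + s, |g x - h (2 * k) x|) + s ^ n * (ε / 2) := by
            rw [integral_add ((hgdiff _).mono_set hQ) (integrableOn_const hfin),
              setIntegral_const, hv, smul_eq_mul]
        _ ≤ 2 * ((3 ^ n + 3) * s ^ n) * (1 / 2) ^ k + s ^ n * (ε / 2) := by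
            gcongr
            exact htail k hkK a s hs hQ hzQ
        _ = s ^ n * (2 * (3 ^ n + 3) * (1 / 2) ^ k + ε / 2) := by ring
        _ ≤ s ^ n * ε := by
            gcongr
            linarith
    have hsn : 0 < s ^ n := by positivity
    have heq : (s ^ n)⁻¹ * (∫ x in Icc a fun i => a i + s, g x) - h (2 * k) z =
        (s ^ n)⁻¹ * ((∫ x in Icc a fun i => a i + s, g x) - s ^ n * h (2 * k) z) := by
      field_simp
    rw [heq, abs_mul, abs_of_pos (inv_pos.2 hsn), inv_mul_le_iff₀ hsn]
    exact hcalc)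
  refine ⟨L, fun ε hε => ?_⟩
  obtain ⟨δ, hδ, h'⟩ := hL ε hε
  exact ⟨δ, hδ, fun Q hQ hzQ hQδ => h' Q ⟨hQ, hzQ, hQδ⟩⟩

end Schnorr

namespace Schnorr

open MeasureTheory Set

variable {n : ℕ}

attribute [local irreducible] Computable

/-! ### Dyadic decomposition of the sets of a test -/

/-- The predicate "the closed cell `v` is contained in the open cube named by `d`". -/
def cellInCube (N : ℕ) (v : Fin n → ℕ) (d : CubeCode n) : Bool :=
  -- Rational inequalities with denominators cleared and negative terms moved across, so that only
  -- natural numbers occur.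
  decide (d.2.2.1 < d.2.1) &&
    decide (∀ i, (decide ((d.1 i).1 * 2 ^ N < v i * ((d.1 i).2.2 + 1) + (d.1 i).2.1 * 2 ^ N) &&
      decide (((v i + 1) * ((d.1 i).2.2 + 1) + 2 ^ N * (d.1 i).2.1) * (d.2.2.2 + 1) +
        2 ^ N * d.2.2.1 * ((d.1 i).2.2 + 1) <
        2 ^ N * ((d.1 i).1 * (d.2.2.2 + 1) + d.2.1 * ((d.1 i).2.2 + 1)))) = true)

@[fun_prop] theorem computable_cellInCube {α : Type*} [Primcodable α] {N : α → ℕ}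
    {v : α → Fin n → ℕ} {d : α → CubeCode n} (hN : Computable N) (hv : Computable v)
    (hd : Computable d) : Computable fun a => cellInCube (N a) (v a) (d a) := by
  unfold cellInCube
  fun_prop

theorem cellInCube_iff {N : ℕ} {v : Fin n → ℕ} {d : CubeCode n} :
    cellInCube N v d = true ↔ 0 < RatCode.val d.2 ∧ ∀ i, ratPoint d.1 i < v i / 2 ^ N ∧
      ((v i : ℝ) + 1) / 2 ^ N < ratPoint d.1 i + (RatCode.val d.2 : ℚ) := by
  have hp := pow_pos (two_pos (α := ℝ)) N
  rw [cellInCube, Bool.and_eq_true, decide_eq_true_eq, decide_eq_true_eq]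
  refine and_congr ?_ (forall_congr' fun i => ?_)
  · rw [RatCode.val, div_pos_iff_of_pos_right (by positivity), sub_pos, Nat.cast_lt]
  · rw [Bool.and_eq_true, decide_eq_true_eq, decide_eq_true_eq, ratPoint, RatCode.cast_val,
      RatCode.cast_val]
    have h1 : (0 : ℝ) < (d.1 i).2.2 + 1 := by positivity
    have h2 : (0 : ℝ) < d.2.2.2 + 1 := by positivity
    refine and_congr ?_ ?_
    · rw [div_lt_div_iff₀ h1 hp, ← Nat.cast_lt (α := ℝ)]
      push_cast
      constructor <;> intro h <;> linarith
    · rw [div_add_div _ _ h1.ne' h2.ne', div_lt_div_iff₀ hp (by positivity),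
        ← Nat.cast_lt (α := ℝ)]
      push_cast
      constructor <;> intro h <;> linarith

/-- The closed cell `v` is contained in one of the first `N` cubes. -/
def covered (c : ℕ → ℕ → CubeCode n) (m N : ℕ) (v : Fin n → ℕ) : Bool :=
  decide (∃ i < N, cellInCube N v (c m i) = true)

theorem computable_covered {c : ℕ → ℕ → CubeCode n} (hc : Computable₂ c) {α : Type*}
    [Primcodable α] {m N : α → ℕ} {v : α → Fin n → ℕ} (hm : Computable m) (hN : Computable N)
    (hv : Computable v) : Computable fun a => covered c (m a) (N a) (v a) := by
  have hc' : Computable fun p : ℕ × ℕ => c p.1 p.2 := hc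
  unfold covered
  fun_prop

/-- Subcells inherit containment, and a higher level allows more cubes. -/
theorem covered_mono {c : ℕ → ℕ → CubeCode n} {m N S : ℕ} (h : N ≤ S) {v : Fin n → ℕ}
    (hv : covered c m N (fun i => v i / 2 ^ (S - N)) = true) : covered c m S v = true := by
  simp only [covered, decide_eq_true_eq] at hv ⊢
  obtain ⟨j, hj, hv⟩ := hv
  refine ⟨j, hj.trans_le h, ?_⟩
  rw [cellInCube_iff] at hv ⊢
  refine ⟨hv.1, fun i => ?_⟩
  obtain ⟨h1, h2⟩ := hv.2 i
  have hS : (2 : ℝ) ^ S = 2 ^ (S - N) * 2 ^ N := by rw [← pow_add, Nat.sub_add_cancel h]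
  have h3 : ((v i / 2 ^ (S - N) : ℕ) : ℝ) * 2 ^ (S - N) ≤ v i := by
    exact_mod_cast Nat.div_mul_le_self _ _
  have h4 : (v i : ℝ) + 1 ≤ (((v i / 2 ^ (S - N) : ℕ) : ℝ) + 1) * 2 ^ (S - N) := by
    exact_mod_cast Nat.lt_mul_of_div_lt (Nat.lt_succ_self _) (by positivity)
  constructor
  · refine h1.trans_le ?_
    rw [div_le_div_iff₀ (by positivity) (by positivity), hS]
    nlinarith [pow_pos (two_pos (α := ℝ)) N]
  · refine lt_of_le_of_lt ?_ h2
    rw [div_le_div_iff₀ (by positivity) (by positivity), hS]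
    nlinarith [pow_pos (two_pos (α := ℝ)) N]

theorem mem_iUnion_of_covered {c : ℕ → ℕ → CubeCode n} {m N : ℕ} {v : Fin n → ℕ}
    (hv : covered c m N v = true) {x : Fin n → ℝ}
    (hx : ∀ i, (v i : ℝ) ≤ x i * 2 ^ N ∧ x i * 2 ^ N ≤ v i + 1) :
    x ∈ ⋃ i, openCube (c m i) := by
  simp only [covered, decide_eq_true_eq] at hv
  obtain ⟨j, -, hv⟩ := hv
  rw [cellInCube_iff] at hv
  refine mem_iUnion.2 ⟨j, hv.1, fun i => ⟨?_, ?_⟩⟩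
  · exact (hv.2 i).1.trans_le ((div_le_iff₀ (by positivity)).2 (hx i).1)
  · exact ((le_div_iff₀ (by positivity)).2 (hx i).2).trans_lt (hv.2 i).2

/-- A point has a margin `ρ` inside some open cube; closed cells of side below `ρ` around it lie in
that cube, which is inspected once the level exceeds its index. -/
theorem exists_covered {c : ℕ → ℕ → CubeCode n} {m : ℕ} {x : Fin n → ℝ}
    (hx : x ∈ ⋃ i, openCube (c m i)) : ∃ N₀, ∀ N ≥ N₀, ∀ v : Fin n → ℕ,
      (∀ i, (v i : ℝ) ≤ x i * 2 ^ N ∧ x i * 2 ^ N ≤ v i + 1) → covered c m N v = true := by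
  obtain ⟨j, h0, hj⟩ := mem_iUnion.1 hx
  obtain ⟨ρ, hρ, hρx⟩ : ∃ ρ > 0, ∀ i, ratPoint (c m j).1 i < x i - ρ ∧
      x i + ρ < ratPoint (c m j).1 i + ((c m j).2.val : ℚ) := by
    have h : ∀ i, ∀ᶠ ρ in nhdsWithin (0 : ℝ) (Ioi 0), ratPoint (c m j).1 i < x i - ρ ∧
        x i + ρ < ratPoint (c m j).1 i + ((c m j).2.val : ℚ) := fun i => by
      have h1 : Filter.Tendsto (fun ρ : ℝ => x i - ρ) (nhdsWithin 0 (Ioi 0)) (nhds (x i - 0)) :=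
        ((continuous_const.sub continuous_id).tendsto 0).mono_left nhdsWithin_le_nhds
      have h2 : Filter.Tendsto (fun ρ : ℝ => x i + ρ) (nhdsWithin 0 (Ioi 0)) (nhds (x i + 0)) :=
        ((continuous_const.add continuous_id).tendsto 0).mono_left nhdsWithin_le_nhds
      rw [sub_zero] at h1
      rw [add_zero] at h2
      exact (h1.eventually (lt_mem_nhds (hj i).1)).and (h2.eventually (gt_mem_nhds (hj i).2))
    obtain ⟨ρ, hρ, hρ'⟩ := ((Filter.eventually_all.2 h).and self_mem_nhdsWithin).exists
    exact ⟨ρ, hρ', hρ⟩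
  obtain ⟨M, hM⟩ := exists_pow_lt_of_lt_one hρ (by norm_num : (1 / 2 : ℝ) < 1)
  refine ⟨max M (j + 1), fun N hN v hv => ?_⟩
  have hp := pow_pos (two_pos (α := ℝ)) N
  have hN' : 1 / (2 : ℝ) ^ N < ρ := by
    rw [← one_div_pow]
    exact (pow_le_pow_of_le_one (by norm_num) (by norm_num)
      ((le_max_left _ _).trans hN)).trans_lt hM
  simp only [covered, decide_eq_true_eq]
  refine ⟨j, (Nat.lt_succ_self j).trans_le ((le_max_right _ _).trans hN),
    cellInCube_iff.2 ⟨h0, fun i => ?_⟩⟩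
  have h1 : (v i : ℝ) / 2 ^ N ≤ x i := (div_le_iff₀ hp).2 (hv i).1
  have h2 : x i ≤ ((v i : ℝ) + 1) / 2 ^ N := (le_div_iff₀ hp).2 (hv i).2
  rw [add_div] at h2 ⊢
  have := hρx i
  constructor <;> linarith

/-! ### Scanning the cells containing a point -/

/-- Reads the cells `u 0, u 1, …` containing a point. The state is a parity together with the level
`ℓ` of the last marked cell. A cell is marked, and the parity flipped, when it is covered by the
member of the test whose measure is small in comparison with the cell marked before. -/
def scan (c : ℕ → ℕ → CubeCode n) (u : ℕ → Fin n → ℕ) : ℕ → Bool × ℕ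
  | 0 => (false, 0)
  -- With `ℓ` the last marked level, the part `n * ℓ + 2` of the index makes the member at most a
  -- quarter of the marked cell; the further `ℓ` makes these measures summable.
  | j + 1 => if covered c ((n + 1) * (scan c u j).2 + 2) (j + 1) (u (j + 1)) then
      (!(scan c u j).1, j + 1) else scan c u j

theorem scan_congr {c : ℕ → ℕ → CubeCode n} {u u' : ℕ → Fin n → ℕ} {j : ℕ}
    (h : ∀ i ≤ j, u i = u' i) : scan c u j = scan c u' j := by
  induction j with
  | zero => rfl
  | succ j ih => rw [scan, scan, ih fun i hi => h i (hi.trans j.le_succ), h (j + 1) le_rfl]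

theorem scan_snd_le (c : ℕ → ℕ → CubeCode n) (u : ℕ → Fin n → ℕ) (j : ℕ) :
    (scan c u j).2 ≤ j := by
  induction j with
  | zero => rfl
  | succ j ih =>
    rw [scan]
    split_ifs
    · exact le_rfl
    · exact ih.trans j.le_succ

/-- If level `j` was not marked, the cell there was tested against the member given by the unchanged
state, and refused. -/
theorem not_covered_of_scan {c : ℕ → ℕ → CubeCode n} {u : ℕ → Fin n → ℕ} {j : ℕ}
    (h : (scan c u j).2 < j) :
    covered c ((n + 1) * (scan c u j).2 + 2) j (u j) = false := by
  cases j with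
  | zero => simp at h
  | succ j =>
    rw [scan] at h ⊢
    split_ifs at h ⊢ with hc
    · simp at h
    · simpa using hc

/-- The first change of state after `s` is a mark made from the state at `s`. -/
theorem scan_const_or_marks (c : ℕ → ℕ → CubeCode n) (u : ℕ → Fin n → ℕ) (s : ℕ) :
    (∀ j ≥ s, scan c u j = scan c u s) ∨ ∃ j ≥ s, scan c u j = scan c u s ∧
      covered c ((n + 1) * (scan c u s).2 + 2) (j + 1) (u (j + 1)) = true := by
  by_contra! h
  obtain ⟨⟨j, hj, hne⟩, h2⟩ := h
  induction j, hj using Nat.le_induction with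
  | base => exact hne rfl
  | succ j hj ih =>
    by_cases heq : scan c u j = scan c u s
    · refine hne ?_
      rw [scan, heq, if_neg (h2 j hj heq)]
    · exact ih heq

/-- The parity after reading the cells of level at most `s` above the cell `v` of level `s`. -/
def scanCell (c : ℕ → ℕ → CubeCode n) (s : ℕ) (v : Fin n → ℕ) : Bool :=
  (scan c (fun j i => v i / 2 ^ (s - j)) s).1

theorem computable_scanCell {c : ℕ → ℕ → CubeCode n} (hc : Computable₂ c) {α : Type*}
    [Primcodable α] {s : α → ℕ} {v : α → Fin n → ℕ} (hs : Computable s) (hv : Computable v) :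
    Computable fun a => scanCell c (s a) (v a) := by
  have hstep : Computable fun p : α × ℕ × Bool × ℕ =>
      if covered c ((n + 1) * p.2.2.2 + 2) (p.2.1 + 1)
        (fun i => v p.1 i / 2 ^ (s p.1 - (p.2.1 + 1))) then (!p.2.2.1, p.2.1 + 1) else p.2.2 := by
    have := computable_covered hc (α := α × ℕ × Bool × ℕ)
      (m := fun p => (n + 1) * p.2.2.2 + 2) (N := fun p => p.2.1 + 1)
      (v := fun p i => v p.1 i / 2 ^ (s p.1 - (p.2.1 + 1))) (by fun_prop) (by fun_prop)
      (by fun_prop)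
    fun_prop
  have h := Computable.nat_iterate (f := fun a j (t : Bool × ℕ) =>
    if covered c ((n + 1) * t.2 + 2) (j + 1) (fun i => v a i / 2 ^ (s a - (j + 1))) then
      (!t.1, j + 1) else t) hs (Computable.const (false, 0)) hstep
  have h' : ∀ a t k, scan c (fun j i => v a i / 2 ^ (t - j)) k =
      Nat.rec (motive := fun _ => Bool × ℕ) (false, 0) (fun j (b : Bool × ℕ) =>
        if covered c ((n + 1) * b.2 + 2) (j + 1) (fun i => v a i / 2 ^ (t - (j + 1))) then
          (!b.1, j + 1) else b) k := fun a t k => by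
    induction k with
    | zero => rfl
    | succ j ih => rw [scan, ih]
  unfold scanCell
  simp only [h']
  fun_prop

theorem scan_cellIndex (c : ℕ → ℕ → CubeCode n) (x : Fin n → ℝ) (s : ℕ) :
    scan c (fun j => cellIndex j x) s =
      scan c (fun j i => cellIndex s x i / 2 ^ (s - j)) s :=
  scan_congr fun _ hj => cellIndex_coarsen hj x

open Classical in
/-- The limit of the parities along the cells containing `x`, if there is one. -/
noncomputable def parityLimit (c : ℕ → ℕ → CubeCode n) (x : Fin n → ℝ) : ℝ :=
  -- Points where the parity flips forever get the value `0`.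
  if ∃ s, ∀ j ≥ s, (scan c (fun j => cellIndex j x) j).1 = true then 1 else 0

theorem parityLimit_nonneg (c : ℕ → ℕ → CubeCode n) (x : Fin n → ℝ) : 0 ≤ parityLimit c x := by
  unfold parityLimit
  split_ifs <;> norm_num

theorem parityLimit_le_one (c : ℕ → ℕ → CubeCode n) (x : Fin n → ℝ) : parityLimit c x ≤ 1 := by
  unfold parityLimit
  split_ifs <;> norm_num

theorem measurable_parityLimit (c : ℕ → ℕ → CubeCode n) : Measurable (parityLimit c) := by
  refine Measurable.ite ?_ measurable_const measurable_const
  have : {x : Fin n → ℝ | ∃ s, ∀ j ≥ s, (scan c (fun j => cellIndex j x) j).1 = true} =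
      ⋃ s : ℕ, ⋂ j ≥ s, cellIndex j ⁻¹' {v | scanCell c j v = true} := by
    ext x
    simp only [mem_iUnion, mem_iInter, mem_preimage, mem_ofPred_eq, scanCell]
    exact exists_congr fun s => forall₂_congr fun j _ => by rw [scan_cellIndex]
  rw [this]
  exact MeasurableSet.iUnion fun s => MeasurableSet.iInter fun j => MeasurableSet.iInter fun _ =>
    measurable_cellIndex j .of_discrete

theorem integrableOn_parityLimit (c : ℕ → ℕ → CubeCode n) :
    IntegrableOn (parityLimit c) (unitCube n) :=
  Measure.integrableOn_of_bounded (M := 1) (by simp [volume_unitCube])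
    (measurable_parityLimit c).aestronglyMeasurable
    (.of_forall fun x => by
      rw [Real.norm_eq_abs, abs_of_nonneg (parityLimit_nonneg c x)]
      exact parityLimit_le_one c x)

/-- The value that `parityLimit` has if nothing is marked after level `s`. -/
noncomputable def parityAt (c : ℕ → ℕ → CubeCode n) (s : ℕ) (x : Fin n → ℝ) : ℝ :=
  if scanCell c s (cellIndex s x) = true then 1 else 0

/-- Without a mark after `s` the parity is final; otherwise the next mark places the cell of `x` in
the member fixed by the state at `s`. Both the error bound and the oscillation rest on this. -/
theorem parityLimit_eq_or (c : ℕ → ℕ → CubeCode n) (s : ℕ) (x : Fin n → ℝ) :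
    parityLimit c x = parityAt c s x ∨ ∃ j ≥ s,
      covered c ((n + 1) * (scan c (fun j => cellIndex j x) s).2 + 2) (j + 1)
        (cellIndex (j + 1) x) = true := by
  rcases scan_const_or_marks c (fun j => cellIndex j x) s with h | ⟨j, hj, -, h⟩
  · left
    have hiff : (∃ t, ∀ j ≥ t, (scan c (fun j => cellIndex j x) j).1 = true) ↔
        scanCell c s (cellIndex s x) = true := by
      rw [scanCell, ← scan_cellIndex]
      refine ⟨?_, fun hs => ⟨s, fun j hj => by rwa [h j hj]⟩⟩
      rintro ⟨t, ht⟩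
      rw [← h (max s t) (le_max_left _ _)]
      exact ht _ (le_max_right _ _)
    unfold parityLimit parityAt
    by_cases hs : scanCell c s (cellIndex s x) = true
    · rw [if_pos (hiff.2 hs), if_pos hs]
    · rw [if_neg (mt hiff.1 hs), if_neg hs]
  · exact .inr ⟨j, hj, h⟩

/-- The part of the `m`-th member of the test in `[0,1)^n`. -/
def testSet (c : ℕ → ℕ → CubeCode n) (m : ℕ) : Set (Fin n → ℝ) :=
  halfCube n ∩ ⋃ i, openCube (c m i)

theorem mem_testSet_of_covered {c : ℕ → ℕ → CubeCode n} {m N : ℕ} {x : Fin n → ℝ}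
    (hx : x ∈ halfCube n) (h : covered c m N (cellIndex N x) = true) : x ∈ testSet c m :=
  ⟨hx, mem_iUnion_of_covered h fun i => by
    have := cell_index_bounds (N := N) (halfCube_subset_unitCube hx) i
    exact ⟨this.1, this.2.le⟩⟩

/-- The points of the `m`-th member of the test that are not recognized at level `s`. -/
def missedSet (c : ℕ → ℕ → CubeCode n) (m s : ℕ) : Set (Fin n → ℝ) :=
  testSet c m \ {x ∈ halfCube n | covered c m s (cellIndex s x) = true}

/-- An error requires a later mark, hence membership in the member given by the last mark `l`. If `l
≤ L < s`, the cell at level `s` was refused for that member, so `x` was missed; if `l > L`, the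
member belongs to the tail. -/
theorem mem_of_parityLimit_ne {c : ℕ → ℕ → CubeCode n} {s L : ℕ} (hL : L < s) {x : Fin n → ℝ}
    (hx : x ∈ halfCube n) (hne : parityLimit c x ≠ parityAt c s x) :
    x ∈ (⋃ l ∈ Finset.range (L + 1), missedSet c ((n + 1) * l + 2) s) ∪
      ⋃ k, testSet c ((n + 1) * (L + 1 + k) + 2) := by
  obtain ⟨j, -, hj⟩ := (parityLimit_eq_or c s x).resolve_left hne
  have hmem := mem_testSet_of_covered hx hj
  set l := (scan c (fun j => cellIndex j x) s).2 with hl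
  rcases le_or_gt l L with h | h
  · left
    refine mem_iUnion₂.2 ⟨l, Finset.mem_range.2 (Nat.lt_succ_of_le h), hmem, fun hx' => ?_⟩
    have := not_covered_of_scan (c := c) (u := fun j => cellIndex j x) (hl ▸ h.trans_lt hL)
    rw [← hl] at this
    simp [hx'.2] at this
  · right
    refine mem_iUnion.2 ⟨l - (L + 1), ?_⟩
    rwa [Nat.add_sub_cancel' h]

end Schnorr

namespace Schnorr

open MeasureTheory Set

variable {n : ℕ}

attribute [local irreducible] Computable

/-! ### Continuous approximations of step functions -/

/-- A function vanishing at the integers and equal to `1` at distance `1 / K` from them. -/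
noncomputable def bump (K t : ℝ) : ℝ := min 1 (K * |t - round t|)

theorem bump_nonneg {K : ℝ} (hK : 0 ≤ K) (t : ℝ) : 0 ≤ bump K t :=
  le_min zero_le_one (mul_nonneg hK (abs_nonneg _))

theorem bump_le_one (K t : ℝ) : bump K t ≤ 1 := min_le_left _ _

theorem abs_bump_sub_le {K : ℝ} (hK : 0 ≤ K) (t u : ℝ) : |bump K t - bump K u| ≤ K * |t - u| := by
  have key : ∀ t u : ℝ, bump K t ≤ bump K u + K * |t - u| := fun t u => by
    have h1 : |t - round t| ≤ |u - round u| + |t - u| :=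
      (round_le t (round u)).trans (by
        have := abs_sub_le t u (round u)
        linarith)
    rw [bump, bump, ← min_add_add_right]
    refine le_min ((min_le_left _ _).trans ?_) ((min_le_right _ _).trans ?_)
    · have := mul_nonneg hK (abs_nonneg (t - u))
      linarith
    · rw [← mul_add]
      exact mul_le_mul_of_nonneg_left h1 hK
  rw [abs_sub_le_iff]
  constructor
  · linarith [key t u]
  · rw [abs_sub_comm]
    linarith [key u t]

/-- An integer separates `t` from `u`, and the distance of `t` to it is at most `|t - u|`. -/
theorem bump_le_of_floor_ne {K : ℝ} (hK : 0 ≤ K) {t u : ℝ} (ht : 0 ≤ t) (hu : 0 ≤ u)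
    (h : ⌊t⌋₊ ≠ ⌊u⌋₊) : bump K t ≤ K * |t - u| := by
  refine (min_le_right _ _).trans (mul_le_mul_of_nonneg_left ?_ hK)
  rcases lt_or_gt_of_ne h with h | h
  · have h1 : t < ⌊u⌋₊ := (Nat.floor_lt ht).1 h
    have h2 := Nat.floor_le hu
    refine (round_le t (⌊u⌋₊ : ℤ)).trans ?_
    rw [Int.cast_natCast, abs_sub_comm, abs_of_pos (by linarith), abs_sub_comm,
      abs_of_nonneg (by linarith)]
    linarith
  · have h1 : u < ⌊t⌋₊ := (Nat.floor_lt hu).1 h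
    have h2 := Nat.floor_le ht
    refine (round_le t (⌊t⌋₊ : ℤ)).trans ?_
    rw [Int.cast_natCast, abs_of_nonneg (by linarith), abs_of_nonneg (by linarith)]
    linarith

theorem bump_div (K a d : ℕ) (hd : 0 < d) :
    bump K ((a : ℝ) / d) = (min d (K * min (a % d) (d - a % d)) : ℕ) / (d : ℝ) := by
  have hd' : (0 : ℝ) < d := Nat.cast_pos.2 hd
  have hfract : Int.fract ((a : ℝ) / d) = ((a % d : ℕ) : ℝ) / d := by
    rw [Int.fract_eq_iff]
    refine ⟨by positivity, (div_lt_one hd').2 (Nat.cast_lt.2 (Nat.mod_lt _ hd)),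
      (a / d : ℕ), ?_⟩
    rw [← sub_div, Int.cast_natCast, eq_comm, eq_div_iff hd'.ne', eq_sub_iff_add_eq]
    exact_mod_cast Nat.div_add_mod' a d
  rw [bump, abs_sub_round_eq_min, hfract, Nat.cast_min, Nat.cast_mul, Nat.cast_min,
    Nat.cast_sub (Nat.mod_lt _ hd).le, ← min_div_div_right hd'.le, div_self hd'.ne', mul_div_assoc,
    ← min_div_div_right hd'.le, sub_div, div_self hd'.ne']

theorem abs_prod_sub_prod_le {ι : Type*} (s : Finset ι) {a b : ι → ℝ}
    (ha : ∀ i, 0 ≤ a i ∧ a i ≤ 1) (hb : ∀ i, 0 ≤ b i ∧ b i ≤ 1) :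
    |∏ i ∈ s, a i - ∏ i ∈ s, b i| ≤ ∑ i ∈ s, |a i - b i| := by
  classical
  induction s using Finset.induction_on with
  | empty => simp
  | insert j s hj ih =>
    rw [Finset.prod_insert hj, Finset.prod_insert hj, Finset.sum_insert hj]
    have h1 : |∏ i ∈ s, a i| ≤ 1 := by
      rw [abs_of_nonneg (Finset.prod_nonneg fun i _ => (ha i).1)]
      exact Finset.prod_le_one (fun i _ => (ha i).1) fun i _ => (ha i).2
    have h2 : |b j| ≤ 1 := by
      rw [abs_of_nonneg (hb j).1]
      exact (hb j).2
    calc _ = |(a j - b j) * ∏ i ∈ s, a i + b j * (∏ i ∈ s, a i - ∏ i ∈ s, b i)| := by ring_nf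
      _ ≤ |a j - b j| * |∏ i ∈ s, a i| + |b j| * |∏ i ∈ s, a i - ∏ i ∈ s, b i| := by
          rw [← abs_mul, ← abs_mul]
          exact abs_add_le _ _
      _ ≤ |a j - b j| * 1 + 1 * ∑ i ∈ s, |a i - b i| := by gcongr
      _ = _ := by ring

/-- The points of `[0,1)` at which `bump K (t * 2^s) = 1`. -/
def innerSet (s : ℕ) (K : ℝ) : Set ℝ := {t ∈ Ico 0 1 | bump K (t * 2 ^ s) = 1}

theorem continuous_bump {K : ℝ} (hK : 0 ≤ K) : Continuous (bump K) := by
  refine LipschitzWith.continuous (K := ⟨K, hK⟩) (LipschitzWith.of_dist_le_mul fun t u => ?_)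
  rw [Real.dist_eq, Real.dist_eq]
  exact abs_bump_sub_le hK t u

theorem measurableSet_innerSet (s : ℕ) {K : ℝ} (hK : 0 ≤ K) : MeasurableSet (innerSet s K) :=
  measurableSet_Ico.inter
    (((continuous_bump hK).comp (continuous_mul_const _)).measurable (measurableSet_singleton 1))

/-- What is lost lies in two intervals of length `2^(-s) / K` at the ends of each of `2^s` cells. -/
theorem volume_real_innerSet_ge (s : ℕ) {K : ℝ} (hK : 0 < K) :
    1 - 2 / K ≤ volume.real (innerSet s K) := by
  have hp := pow_pos (two_pos (α := ℝ)) s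
  have hcov : Ico (0 : ℝ) 1 \ innerSet s K ⊆ ⋃ j ∈ Finset.range (2 ^ s),
      (Icc ((j : ℝ) / 2 ^ s) ((j + 1 / K) / 2 ^ s) ∪
        Icc ((j + 1 - 1 / K) / 2 ^ s) (((j : ℝ) + 1) / 2 ^ s)) := by
    rintro t ⟨ht, hti⟩
    have hlt : K * |t * 2 ^ s - round (t * 2 ^ s)| < 1 := by
      by_contra! hge
      exact hti ⟨ht, min_eq_left hge⟩
    have ht0 : 0 ≤ t * 2 ^ s := mul_nonneg ht.1 hp.le
    have h1 := Nat.floor_le ht0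
    have h2 := Nat.lt_floor_add_one (t * 2 ^ s)
    refine mem_iUnion₂.2 ⟨⌊t * 2 ^ s⌋₊, ?_, ?_⟩
    · rw [Finset.mem_range, Nat.floor_lt ht0]
      push_cast
      nlinarith [ht.2]
    · rw [abs_sub_round_eq_min, ← lt_div_iff₀' hK, min_lt_iff] at hlt
      rw [Int.fract, ← natCast_floor_eq_intCast_floor ht0] at hlt
      rcases hlt with hlt | hlt
      · left
        rw [mem_Icc, div_le_iff₀ hp, le_div_iff₀ hp]
        constructor <;> linarith
      · right
        rw [mem_Icc, div_le_iff₀ hp, le_div_iff₀ hp]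
        constructor <;> linarith
  have hle : volume.real (Ico (0 : ℝ) 1 \ innerSet s K) ≤ 2 / K := by
    have hcompact : IsCompact (⋃ j ∈ Finset.range (2 ^ s),
        (Icc ((j : ℝ) / 2 ^ s) ((j + 1 / K) / 2 ^ s) ∪
          Icc ((j + 1 - 1 / K) / 2 ^ s) (((j : ℝ) + 1) / 2 ^ s))) :=
      Finset.isCompact_biUnion _ fun j _ => isCompact_Icc.union isCompact_Icc
    have hlen : ∀ j : ℕ, volume.real (Icc ((j : ℝ) / 2 ^ s) ((j + 1 / K) / 2 ^ s) ∪
        Icc ((j + 1 - 1 / K) / 2 ^ s) (((j : ℝ) + 1) / 2 ^ s)) ≤ 2 / K / 2 ^ s := fun j => by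
      refine (measureReal_union_le _ _).trans_eq ?_
      have h0 : 0 ≤ 1 / K := by positivity
      rw [Real.volume_real_Icc_of_le (by gcongr; linarith),
        Real.volume_real_Icc_of_le (by gcongr; linarith)]
      ring
    refine ((measureReal_mono hcov hcompact.measure_ne_top).trans
      (measureReal_biUnion_finset_le _ _)).trans ((Finset.sum_le_sum fun j _ => hlen j).trans_eq ?_)
    rw [Finset.sum_const, Finset.card_range, nsmul_eq_mul]
    push_cast
    field_simp
  have hadd := measureReal_union_le (μ := volume) (innerSet s K) (Ico (0 : ℝ) 1 \ innerSet s K)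
  have hsub : innerSet s K ⊆ Ico 0 1 := fun t ht => ht.1
  rw [union_sdiff_cancel hsub, Real.volume_real_Ico_of_le zero_le_one] at hadd
  linarith

theorem volume_real_pi_innerSet_ge (s : ℕ) {K : ℝ} (hK : 2 ≤ K) :
    1 - 2 * n / K ≤ volume.real (univ.pi fun _ : Fin n => innerSet s K) := by
  have h1 := volume_real_innerSet_ge s (by linarith : 0 < K)
  have h2 : 2 / K ≤ 1 := (div_le_one (by linarith)).2 hK
  rw [measureReal_def, volume_pi_pi, Finset.prod_const, Finset.card_univ, Fintype.card_fin,
    ENNReal.toReal_pow]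
  calc 1 - 2 * n / K = 1 + n * (-(2 / K)) := by ring
    -- Bernoulli's inequality.
    _ ≤ (1 + -(2 / K)) ^ n := one_add_mul_le_pow (by linarith) n
    _ ≤ _ := by
        gcongr
        · linarith
        · rw [← sub_eq_add_neg]
          exact h1

section Smoothing

variable {s : ℕ → ℕ} {b : ℕ → (Fin n → ℕ) → Bool}

/-- The step function with values `b v` on the cells `v` of level `s`. -/
noncomputable def stepFun (s : ℕ) (b : (Fin n → ℕ) → Bool) (x : Fin n → ℝ) : ℝ :=
  if b (cellIndex s x) = true then 1 else 0

/-- A continuous approximation of `stepFun s b`. -/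
noncomputable def smoothStep (s : ℕ) (K : ℝ) (b : (Fin n → ℕ) → Bool) (x : Fin n → ℝ) : ℝ :=
  stepFun s b x * ∏ i, bump K (x i * 2 ^ s)

theorem stepFun_mem (s : ℕ) (b : (Fin n → ℕ) → Bool) (x : Fin n → ℝ) :
    0 ≤ stepFun s b x ∧ stepFun s b x ≤ 1 := by
  unfold stepFun
  split_ifs <;> norm_num

theorem prod_bump_mem {K : ℝ} (hK : 0 ≤ K) (t : Fin n → ℝ) :
    0 ≤ ∏ i, bump K (t i) ∧ ∏ i, bump K (t i) ≤ 1 :=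
  ⟨Finset.prod_nonneg fun _ _ => bump_nonneg hK _,
    Finset.prod_le_one (fun _ _ => bump_nonneg hK _) fun _ _ => bump_le_one _ _⟩

theorem smoothStep_le_bump {s : ℕ} {K : ℝ} (hK : 0 ≤ K) (b : (Fin n → ℕ) → Bool)
    (x : Fin n → ℝ) (i : Fin n) : smoothStep s K b x ≤ bump K (x i * 2 ^ s) := by
  classical
  calc smoothStep s K b x ≤ 1 * ∏ i, bump K (x i * 2 ^ s) :=
        mul_le_mul_of_nonneg_right (stepFun_mem s b x).2 (prod_bump_mem hK _).1
    _ = bump K (x i * 2 ^ s) * ∏ j ∈ Finset.univ.erase i, bump K (x j * 2 ^ s) := by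
        rw [one_mul]
        exact (Finset.mul_prod_erase Finset.univ (fun j => bump K (x j * 2 ^ s))
          (Finset.mem_univ i)).symm
    _ ≤ bump K (x i * 2 ^ s) * 1 := by
        refine mul_le_mul_of_nonneg_left ?_ (bump_nonneg hK _)
        exact Finset.prod_le_one (fun _ _ => bump_nonneg hK _) fun _ _ => bump_le_one _ _
    _ = _ := mul_one _

/-- Within one cell only the product of bumps varies. Between different cells some coordinate
crosses a face, where its bump vanishes, so both values are already small. -/
theorem abs_smoothStep_sub_le {s : ℕ} {K : ℝ} (hK : 0 ≤ K) (b : (Fin n → ℕ) → Bool)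
    {x y : Fin n → ℝ} (hx : x ∈ unitCube n) (hy : y ∈ unitCube n) :
    |smoothStep s K b x - smoothStep s K b y| ≤ (n + 1) * (K * 2 ^ s) * dist x y := by
  have hp := pow_pos (two_pos (α := ℝ)) s
  have hd : ∀ i, |x i * 2 ^ s - y i * 2 ^ s| ≤ 2 ^ s * dist x y := fun i => by
    rw [← sub_mul, abs_mul, abs_of_pos hp, mul_comm]
    exact mul_le_mul_of_nonneg_left (dist_le_pi_dist x y i) hp.le
  by_cases heq : cellIndex s x = cellIndex s y
  · have hst : stepFun s b x = stepFun s b y := by rw [stepFun, stepFun, heq]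
    rw [smoothStep, smoothStep, hst, ← mul_sub, abs_mul, abs_of_nonneg (stepFun_mem s b y).1]
    calc _ ≤ 1 * |∏ i, bump K (x i * 2 ^ s) - ∏ i, bump K (y i * 2 ^ s)| :=
          mul_le_mul_of_nonneg_right (stepFun_mem s b y).2 (abs_nonneg _)
      _ ≤ ∑ i, |bump K (x i * 2 ^ s) - bump K (y i * 2 ^ s)| := by
          rw [one_mul]
          exact abs_prod_sub_prod_le _ (fun i => ⟨bump_nonneg hK _, bump_le_one _ _⟩)
            fun i => ⟨bump_nonneg hK _, bump_le_one _ _⟩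
      _ ≤ ∑ _i : Fin n, K * (2 ^ s * dist x y) := by
          refine Finset.sum_le_sum fun i _ => (abs_bump_sub_le hK _ _).trans ?_
          exact mul_le_mul_of_nonneg_left (hd i) hK
      _ = n * (K * 2 ^ s) * dist x y := by
          rw [Finset.sum_const, Finset.card_univ, Fintype.card_fin, nsmul_eq_mul]
          ring
      _ ≤ _ := by
          gcongr
          linarith
  · obtain ⟨i, hi⟩ := Function.ne_iff.1 heq
    have hx0 := mul_nonneg (mem_unitCube.1 hx i).1 hp.le
    have hy0 := mul_nonneg (mem_unitCube.1 hy i).1 hp.le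
    have h1 := (smoothStep_le_bump (s := s) hK b x i).trans
      ((bump_le_of_floor_ne hK hx0 hy0 hi).trans (mul_le_mul_of_nonneg_left (hd i) hK))
    have h2 := (smoothStep_le_bump (s := s) hK b y i).trans
      ((bump_le_of_floor_ne hK hy0 hx0 (Ne.symm hi)).trans 
        (mul_le_mul_of_nonneg_left ((abs_sub_comm _ _).trans_le (hd i)) hK))
    have h3 : ∀ x, 0 ≤ smoothStep s K b x := fun x =>
      mul_nonneg (stepFun_mem s b x).1 (prod_bump_mem hK _).1
    calc _ ≤ K * (2 ^ s * dist x y) := by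
          rw [abs_sub_le_iff]
          constructor <;> linarith [h3 x, h3 y]
      _ = 1 * (K * 2 ^ s) * dist x y := by ring
      _ ≤ _ := by
          gcongr
          linarith [Nat.cast_nonneg (α := ℝ) n]

/-- The name of the value of `smoothStep s K b` at a rational point of `[0,1]^n`. -/
def smoothStepCode (s K : ℕ) (b : (Fin n → ℕ) → Bool) (p : Fin n → RatCode) : RatCode :=
  (if b (fun i => ((p i).1 - (p i).2.1) * 2 ^ s / ((p i).2.2 + 1)) then
    ∏ i, min ((p i).2.2 + 1) (K * min (((p i).1 - (p i).2.1) * 2 ^ s % ((p i).2.2 + 1))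
      ((p i).2.2 + 1 - ((p i).1 - (p i).2.1) * 2 ^ s % ((p i).2.2 + 1))) else 0,
    0, ∏ i, ((p i).2.2 + 1) - 1)

theorem val_smoothStepCode (s K : ℕ) (b : (Fin n → ℕ) → Bool) {p : Fin n → RatCode}
    (hp : ratPoint p ∈ unitCube n) :
    ((RatCode.val (smoothStepCode s K b p) : ℚ) : ℝ) = smoothStep s K b (ratPoint p) := by
  have hpt : ∀ i, ratPoint p i * 2 ^ s =
      ((((p i).1 - (p i).2.1) * 2 ^ s : ℕ) : ℝ) / ((p i).2.2 + 1 : ℕ) := fun i => by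
    have h0 := (mem_unitCube.1 hp i).1
    rw [ratPoint, RatCode.cast_val] at h0 ⊢
    have hc : (0 : ℝ) < (p i).2.2 + 1 := by positivity
    -- Coordinates are nonnegative, so the truncated subtraction in the code is exact.
    have hle : (p i).2.1 ≤ (p i).1 := by
      have := (le_div_iff₀ hc).1 h0
      rw [zero_mul] at this
      exact_mod_cast sub_nonneg.1 this
    push_cast [Nat.cast_sub hle]
    ring
  have hidx : cellIndex s (ratPoint p) =
      fun i => ((p i).1 - (p i).2.1) * 2 ^ s / ((p i).2.2 + 1) := by
    funext i
    rw [cellIndex, hpt, Nat.floor_div_eq_div]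
  rw [smoothStepCode, RatCode.cast_val_pred _ _ _ (Finset.prod_pos fun i _ => Nat.succ_pos _),
    smoothStep, stepFun, hidx]
  simp only [hpt]
  split_ifs
  · rw [one_mul, Nat.cast_zero, sub_zero, Nat.cast_prod, Nat.cast_prod, ← Finset.prod_div_distrib]
    exact Finset.prod_congr rfl fun i _ => (bump_div _ _ _ (Nat.succ_pos _)).symm
  · simp

theorem uniformlyComputableFunctions_smoothStep (hs : Computable s)
    (hb : Computable fun q : ℕ × (Fin n → ℕ) => b q.1 q.2) {e : ℕ → ℕ} (he : Computable e) :
    UniformlyComputableFunctions fun k => smoothStep (s k) (2 ^ e k) (b k) := by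
  constructor
  · refine ⟨fun p _ => smoothStepCode (s p.1) (2 ^ e p.1) (b p.1) p.2, ?_, fun p hp _ => ?_⟩
    · change Computable fun p : (ℕ × (Fin n → RatCode)) × ℕ =>
        smoothStepCode (s p.1.1) (2 ^ e p.1.1) (b p.1.1) p.1.2
      unfold smoothStepCode
      fun_prop
    · rw [val_smoothStepCode _ _ _ hp]
      push_cast
      rw [sub_self, abs_zero]
      positivity
  -- The Lipschitz constant `(n + 1) * 2^(e + s)` is at most `2^(n + e + s)`.
  · refine ⟨fun i k => k + (n + (e i + s i)), ?_, fun i k x hx y hy hxy => ?_⟩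
    · change Computable fun p : ℕ × ℕ => p.2 + (n + (e p.1 + s p.1))
      fun_prop
    · have hn : (n : ℝ) + 1 ≤ 2 ^ n := by exact_mod_cast Nat.lt_two_pow_self
      calc _ ≤ ((n : ℝ) + 1) * (2 ^ e i * 2 ^ s i) * dist x y :=
            abs_smoothStep_sub_le (by positivity) _ hx hy
        _ < ((n : ℝ) + 1) * (2 ^ e i * 2 ^ s i) * (1 / 2) ^ (k + (n + (e i + s i))) := by gcongr
        _ ≤ 2 ^ n * (2 ^ e i * 2 ^ s i) * (1 / 2) ^ (k + (n + (e i + s i))) := by gcongr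
        _ = (1 / 2) ^ k * ((2 * (1 / 2)) ^ n * ((2 * (1 / 2)) ^ e i * (2 * (1 / 2)) ^ s i)) := by
            simp only [pow_add, mul_pow]
            ring
        _ = (1 / 2) ^ k := by norm_num

theorem integrableOn_stepFun (s : ℕ) (b : (Fin n → ℕ) → Bool) :
    IntegrableOn (stepFun s b) (halfCube n) :=
  integrableOn_cellIndex s fun v => if b v = true then 1 else 0

theorem setIntegral_abs_stepFun_sub_le (s : ℕ) {K : ℝ} (hK : 2 ≤ K) (b : (Fin n → ℕ) → Bool) :
    ∫ x in halfCube n, |stepFun s b x - smoothStep s K b x| ≤ 2 * n / K := by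
  set T : Set (Fin n → ℝ) := univ.pi fun _ => innerSet s K
  have hK0 : 0 ≤ K := by linarith
  have hTm : MeasurableSet T := MeasurableSet.univ_pi fun _ => measurableSet_innerSet s hK0
  have hTsub : T ⊆ halfCube n := pi_mono fun _ _ _ ht => ht.1
  have hcont : Continuous fun x : Fin n → ℝ => ∏ i, bump K (x i * 2 ^ s) :=
    continuous_finsetProd _ fun i _ => (continuous_bump hK0).comp
      ((continuous_apply i).mul_const _)
  have hpt : ∀ x, |stepFun s b x - smoothStep s K b x| ≤ 1 := fun x => by
    obtain ⟨h1, h2⟩ := stepFun_mem s b x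
    obtain ⟨h3, h4⟩ := prod_bump_mem hK0 fun i => x i * 2 ^ s
    rw [smoothStep, abs_of_nonneg (by nlinarith)]
    nlinarith
  have hint : IntegrableOn (fun x => |stepFun s b x - smoothStep s K b x|) (halfCube n) := by
    refine (((integrableOn_stepFun s b).sub ?_)).abs
    refine (integrableOn_stepFun s b).mul_bdd (c := 1) hcont.aestronglyMeasurable
      (.of_forall fun x => ?_)
    obtain ⟨h3, h4⟩ := prod_bump_mem hK0 fun i => x i * 2 ^ s
    rwa [Real.norm_eq_abs, abs_of_nonneg h3]
  calc _ ≤ ∫ x in halfCube n, (halfCube n \ T).indicator (fun _ => (1 : ℝ)) x := by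
        refine setIntegral_mono_on hint ?_ measurableSet_halfCube fun x hx => ?_
        · exact (integrableOn_const (by simp [volume_halfCube])).indicator
            (measurableSet_halfCube.diff hTm)
        · by_cases hxT : x ∈ T
          · rw [indicator_of_notMem fun h => h.2 hxT, smoothStep,
              Finset.prod_eq_one fun i _ => ((mem_univ_pi.1 hxT) i).2, mul_one, sub_self, abs_zero]
          · rw [indicator_of_mem (show x ∈ halfCube n \ T from ⟨hx, hxT⟩)]
            exact hpt x
    _ = volume.real (halfCube n \ T) := by
        rw [setIntegral_indicator (measurableSet_halfCube.diff hTm),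
          inter_eq_right.2 sdiff_subset, setIntegral_one_eq_measureReal]
    _ = 1 - volume.real T := by
        rw [measureReal_sdiff hTsub hTm (volume_ne_top_of_subset halfCube_subset_unitCube), measureReal_def, volume_halfCube,
          ENNReal.toReal_one]
    _ ≤ 2 * n / K := by
        have := volume_real_pi_innerSet_ge (n := n) s hK
        linarith

end Smoothing

end Schnorr

namespace Schnorr

open MeasureTheory Set

variable {n : ℕ}

attribute [local irreducible] Computable

/-! ### The limit parity is `L₁`-computable -/

theorem testSet_ae_eq (c : ℕ → ℕ → CubeCode n) (m : ℕ) :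
    testSet c m =ᵐ[volume] (unitCube n ∩ ⋃ i, openCube (c m i) : Set (Fin n → ℝ)) :=
  halfCube_ae_eq.inter (Filter.EventuallyEq.refl _ _)

theorem testSet_subset_unitCube (c : ℕ → ℕ → CubeCode n) (m : ℕ) : testSet c m ⊆ unitCube n :=
  inter_subset_left.trans halfCube_subset_unitCube

theorem isOpen_openCube (d : CubeCode n) : IsOpen (openCube d) := by
  have : openCube d = {_x | 0 < d.2.val} ∩
      univ.pi fun i => Ioo (ratPoint d.1 i) (ratPoint d.1 i + (d.2.val : ℚ)) := by
    ext x
    simp [openCube]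
  rw [this]
  exact isOpen_const.inter (isOpen_set_pi finite_univ fun _ _ => isOpen_Ioo)

theorem measurableSet_testSet (c : ℕ → ℕ → CubeCode n) (m : ℕ) : MeasurableSet (testSet c m) :=
  measurableSet_halfCube.inter (isOpen_iUnion fun _ => isOpen_openCube _).measurableSet

/-- The number of cells of level `s` that are recognized as subsets of the `m`-th member. -/
def coveredCount (c : ℕ → ℕ → CubeCode n) (m s : ℕ) : ℕ :=
  ∑ p ∈ Finset.range ((2 ^ s) ^ n), if covered c m s (digits n (2 ^ s) p) then 1 else 0

theorem computable_coveredCount {c : ℕ → ℕ → CubeCode n} (hc : Computable₂ c) :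
    Computable fun p : ℕ × ℕ => coveredCount c p.1 p.2 := by
  have := computable_covered hc (α := (ℕ × ℕ) × ℕ) (m := fun p => p.1.1) (N := fun p => p.1.2)
    (v := fun p => digits n (2 ^ p.1.2) p.2) (by fun_prop) (by fun_prop) (by fun_prop)
  unfold coveredCount
  fun_prop

theorem volume_covered (c : ℕ → ℕ → CubeCode n) (m s : ℕ) :
    volume.real {x ∈ halfCube n | covered c m s (cellIndex s x) = true} =
      coveredCount c m s / ((2 : ℝ) ^ s) ^ n := by
  rw [volume_real_cellIndex (P := fun v => covered c m s v = true), coveredCount,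
    sum_digits fun v => if covered c m s v = true then 1 else 0]
  simp

theorem covered_subset_testSet (c : ℕ → ℕ → CubeCode n) (m s : ℕ) :
    {x ∈ halfCube n | covered c m s (cellIndex s x) = true} ⊆ testSet c m :=
  fun _ hx => mem_testSet_of_covered hx.1 hx.2

theorem volume_missedSet (c : ℕ → ℕ → CubeCode n) (m s : ℕ) :
    volume.real (missedSet c m s) =
      volume.real (testSet c m) - coveredCount c m s / ((2 : ℝ) ^ s) ^ n := by
  rw [missedSet, measureReal_sdiff (covered_subset_testSet c m s)
    (measurableSet_cellIndex s fun v => covered c m s v = true)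
    (volume_ne_top_of_subset (testSet_subset_unitCube c m)), volume_covered]

/-- The recognized parts increase to the whole member; apply continuity of measure from below. -/
theorem exists_volume_missedSet_lt (c : ℕ → ℕ → CubeCode n) (m : ℕ) {ε : ℝ} (hε : 0 < ε) :
    ∃ s₀, ∀ s ≥ s₀, volume.real (missedSet c m s) < ε := by
  have hmono : Monotone fun s => {x ∈ halfCube n | covered c m s (cellIndex s x) = true} := by
    intro s t hst x hx
    refine ⟨hx.1, covered_mono hst ?_⟩
    rw [← cellIndex_coarsen hst]
    exact hx.2
  have hU : ⋃ s, {x ∈ halfCube n | covered c m s (cellIndex s x) = true} = testSet c m := by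
    refine (iUnion_subset fun s => covered_subset_testSet c m s).antisymm fun x hx => ?_
    obtain ⟨N, hN⟩ := exists_covered hx.2
    refine mem_iUnion.2 ⟨N, hx.1, hN N le_rfl _ fun i => ?_⟩
    have := cell_index_bounds (N := N) (testSet_subset_unitCube c m hx) i
    exact ⟨this.1, this.2.le⟩
  have h := tendsto_measure_iUnion_atTop (μ := volume) hmono
  rw [hU] at h
  have h' := (ENNReal.tendsto_toReal
    (volume_ne_top_of_subset (testSet_subset_unitCube c m))).comp h
  obtain ⟨s₀, hs₀⟩ := Metric.tendsto_atTop.1 h' ε hε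
  refine ⟨s₀, fun s hs => ?_⟩
  have h1 := hs₀ s hs
  rw [Real.dist_eq, abs_lt] at h1
  have h2 := volume_covered c m s
  rw [measureReal_def] at h2
  rw [volume_missedSet, measureReal_def, ← h2]
  simp only [Function.comp_apply] at h1
  linarith

/-- Here the computability of the measures enters: comparing an approximate measure with the exact
count of recognized cells certifies that little is missed. With error `η = 2^(-(2k+6))`, the test
allows a gap of `2η`: it succeeds once less than `η` is missed, and success guarantees at most `3η`.
-/
theorem exists_levels {c : ℕ → ℕ → CubeCode n} (hc : Computable₂ c)
    (hm : UniformlyComputableOn univ fun m => volume.real (testSet c m)) :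
    ∃ s : ℕ → ℕ, Computable s ∧ ∀ k, k + 1 < s k ∧ ∀ l < k + 2,
      volume.real (missedSet c ((n + 1) * l + 2) (s k)) ≤ 3 * (1 / 2) ^ (2 * k + 6) := by
  obtain ⟨q, hq, hqm⟩ := hm
  have hq' : Computable fun p : ℕ × ℕ => q p.1 p.2 := hq
  have hcnt := computable_coveredCount hc
  let M : ℕ → ℕ := fun s => (2 ^ s) ^ n
  let Q : ℕ → ℕ → RatCode := fun k l => q ((n + 1) * l + 2) (2 * k + 6)
  let test : ℕ → ℕ → ℕ → Bool := fun k s l =>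
    decide ((Q k l).1 * M s * 2 ^ (2 * k + 6) ≤
      ((Q k l).2.2 + 1) * (coveredCount c ((n + 1) * l + 2) s * 2 ^ (2 * k + 6) + 2 * M s) +
        (Q k l).2.1 * M s * 2 ^ (2 * k + 6))
  have htest : ∀ k s l, test k s l = true ↔ ((Q k l).val : ℝ) ≤
      coveredCount c ((n + 1) * l + 2) s / ((2 : ℝ) ^ s) ^ n + 2 * (1 / 2) ^ (2 * k + 6) := by
    intro k s l
    have h1 : (0 : ℝ) < (Q k l).2.2 + 1 := by positivity
    have h2 : (0 : ℝ) < ((2 : ℝ) ^ s) ^ n := by positivity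
    have h3 : (0 : ℝ) < 2 ^ (2 * k + 6) := by positivity
    simp only [test, M, decide_eq_true_eq]
    rw [RatCode.cast_val, one_div_pow, mul_one_div, div_add_div _ _ h2.ne' h3.ne',
      div_le_div_iff₀ h1 (mul_pos h2 h3), ← Nat.cast_le (α := ℝ)]
    push_cast
    constructor <;> intro h <;> linarith
  have hsearch : ∀ k, ∃ i, decide (¬ ∃ l < k + 2, (!test k (k + 2 + i) l) = true) = true := by
    intro k
    have h : ∀ l, ∃ s₀, ∀ s ≥ s₀, test k s l = true := fun l => by
      obtain ⟨s₀, hs₀⟩ := exists_volume_missedSet_lt c ((n + 1) * l + 2)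
        (by positivity : (0 : ℝ) < (1 / 2) ^ (2 * k + 6))
      refine ⟨s₀, fun s hs => (htest k s l).2 ?_⟩
      have h1 := hs₀ s hs
      have h2 := abs_le.1 (hqm ((n + 1) * l + 2) trivial (2 * k + 6))
      rw [volume_missedSet] at h1
      simp only [Q]
      linarith [h2.1]
    choose s₀ hs₀ using h
    refine ⟨(Finset.range (k + 2)).sup s₀, decide_eq_true ?_⟩
    rintro ⟨l, hl, hneg⟩
    have := Finset.le_sup (f := s₀) (Finset.mem_range.2 hl)
    simp [hs₀ l (k + 2 + (Finset.range (k + 2)).sup s₀) (by omega)] at hneg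
  have hcomp : Computable fun p : ℕ × ℕ =>
      decide (¬ ∃ l < p.1 + 2, (!test p.1 (p.1 + 2 + p.2) l) = true) := by
    have ht : Computable fun p : (ℕ × ℕ) × ℕ => test p.1.1 (p.1.1 + 2 + p.1.2) p.2 := by
      simp only [test, M, Q]
      fun_prop
    have h : Computable fun p : ℕ × ℕ =>
        !decide (∃ l < p.1 + 2, (!test p.1 (p.1 + 2 + p.2) l) = true) := by fun_prop
    exact h.of_eq fun p => by rw [decide_not]
  obtain ⟨f, hf, hfs⟩ := Computable.exists_search
    (p := fun k i => decide (¬ ∃ l < k + 2, (!test k (k + 2 + i) l) = true)) hcomp hsearch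
  refine ⟨fun k => k + 2 + f k, by fun_prop, fun k => ⟨by dsimp only; omega, fun l hl => ?_⟩⟩
  have h1 : test k (k + 2 + f k) l = true := by
    have := of_decide_eq_true (hfs k)
    push Not at this
    simpa using this l hl
  rw [htest] at h1
  have h2 := abs_le.1 (hqm ((n + 1) * l + 2) trivial (2 * k + 6))
  rw [volume_missedSet]
  simp only [Q] at h1
  linarith [h2.2]

/-- Split at `L = k + 1`: the `k + 2 ≤ 2^(k+1)` missed sets contribute at most `3 * 2^(-(k+5))`, the
tail at most `2 * 2^(-(k+4))`. -/
theorem volume_parityLimit_ne_le {c : ℕ → ℕ → CubeCode n}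
    (hle : ∀ m, volume.real (testSet c m) ≤ (1 / 2) ^ m) {k s : ℕ} (hk : k + 1 < s)
    (hs : ∀ l < k + 2, volume.real (missedSet c ((n + 1) * l + 2) s) ≤ 3 * (1 / 2) ^ (2 * k + 6)) :
    volume.real {x ∈ halfCube n | parityLimit c x ≠ parityAt c s x} ≤ (1 / 2) ^ (k + 2) := by
  have hsub : ∀ m, missedSet c m s ⊆ unitCube n := fun m =>
    sdiff_subset.trans (testSet_subset_unitCube c m)
  refine (measureReal_mono (fun x hx => mem_of_parityLimit_ne hk hx.1 hx.2)
    (volume_ne_top_of_subset (union_subset (iUnion₂_subset fun _ _ => hsub _)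
      (iUnion_subset fun _ => testSet_subset_unitCube c _)))).trans
    ((measureReal_union_le _ _).trans ?_)
  have h1 : volume.real (⋃ l ∈ Finset.range (k + 1 + 1), missedSet c ((n + 1) * l + 2) s) ≤
      3 * (1 / 2) ^ (k + 5) := by
    refine (measureReal_biUnion_finset_le _ _).trans
      ((Finset.sum_le_sum fun l hl => hs l (Finset.mem_range.1 hl)).trans ?_)
    rw [Finset.sum_const, Finset.card_range, nsmul_eq_mul]
    have h2 : ((k + 1 + 1 : ℕ) : ℝ) ≤ 2 ^ (k + 1) := by
      exact_mod_cast (Nat.lt_two_pow_self : k + 1 < 2 ^ (k + 1))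
    calc _ ≤ (2 : ℝ) ^ (k + 1) * (3 * (1 / 2) ^ (2 * k + 6)) := by gcongr
      _ = 3 * (1 / 2) ^ (k + 5) * (2 * (1 / 2)) ^ (k + 1) := by
          rw [mul_pow, show 2 * k + 6 = k + 5 + (k + 1) by ring, pow_add (1 / 2 : ℝ)]
          ring
      _ = _ := by norm_num
  have h2 : volume.real (⋃ j, testSet c ((n + 1) * (k + 1 + 1 + j) + 2)) ≤
      2 * (1 / 2) ^ (k + 4) := by
    refine measureReal_iUnion_le_geometric (fun j => testSet_subset_unitCube c _)
      fun j => (hle _).trans ?_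
    rw [← pow_add]
    exact pow_le_pow_of_le_one (by norm_num) (by norm_num) (by nlinarith)
  have h3 : (0 : ℝ) < (1 / 2) ^ k := by positivity
  rw [pow_add] at h1 h2 ⊢
  linarith

theorem setIntegral_abs_parityLimit_sub_le (c : ℕ → ℕ → CubeCode n) (s : ℕ) :
    ∫ x in halfCube n, |parityLimit c x - parityAt c s x| ≤
      volume.real {x ∈ halfCube n | parityLimit c x ≠ parityAt c s x} := by
  have hm : MeasurableSet {x ∈ halfCube n | parityLimit c x ≠ parityAt c s x} :=
    measurableSet_halfCube.inter (measurableSet_eq_fun (measurable_parityLimit c)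
      (Measurable.of_discrete (f := fun v : Fin n → ℕ => if scanCell c s v = true then (1 : ℝ)
        else 0).comp (measurable_cellIndex s))).compl
  rw [← setIntegral_one_eq_measureReal, ← inter_eq_right.2
    (sep_subset (halfCube n) fun x => parityLimit c x ≠ parityAt c s x), ← setIntegral_indicator hm]
  refine setIntegral_mono_on (((integrableOn_parityLimit c).mono_set
    halfCube_subset_unitCube).sub (integrableOn_stepFun s (scanCell c s))).abs
    ((integrableOn_const (by simp [volume_halfCube])).indicator hm) measurableSet_halfCube
    fun x hx => ?_
  by_cases hne : parityLimit c x = parityAt c s x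
  · rw [hne, sub_self, abs_zero]
    exact indicator_nonneg (fun _ _ => zero_le_one) _
  · rw [indicator_of_mem (show x ∈ {x ∈ halfCube n | parityLimit c x ≠ parityAt c s x} from
      ⟨hx, hne⟩), abs_le]
    have h1 := parityLimit_nonneg c x
    have h2 := parityLimit_le_one c x
    have h3 := stepFun_mem s (scanCell c s) x
    change _ ≤ parityAt c s x ∧ parityAt c s x ≤ _ at h3
    constructor <;> linarith

theorem isL1Computable_parityLimit {c : ℕ → ℕ → CubeCode n} (hc : Computable₂ c)
    (hle : ∀ m, volume.real (testSet c m) ≤ (1 / 2) ^ m)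
    (hm : UniformlyComputableOn univ fun m => volume.real (testSet c m)) :
    IsL1Computable (parityLimit c) := by
  obtain ⟨s, hs, hs'⟩ := exists_levels hc hm
  have hb := computable_scanCell hc (α := ℕ × (Fin n → ℕ)) (s := fun q => s q.1)
    (v := fun q => q.2) (by fun_prop) (by fun_prop)
  have hh := uniformlyComputableFunctions_smoothStep hs (b := fun k => scanCell c (s k)) hb
    (e := fun k => k + 4 + n) (by fun_prop)
  refine ⟨integrableOn_parityLimit c, _, hh, fun k => ?_⟩
  rw [setIntegral_unitCube_eq]
  have hpi := (integrableOn_parityLimit c).mono_set halfCube_subset_unitCube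
  have hsi := integrableOn_stepFun (s k) (scanCell c (s k))
  have hhi := (hh.integrableOn k).mono_set halfCube_subset_unitCube
  have h1 := (setIntegral_abs_parityLimit_sub_le c (s k)).trans
    (volume_parityLimit_ne_le hle (hs' k).1 (hs' k).2)
  have h2 := setIntegral_abs_stepFun_sub_le (s k) (K := 2 ^ (k + 4 + n))
    (le_self_pow₀ one_le_two (by omega)) (scanCell c (s k))
  have h3 : 2 * (n : ℝ) / 2 ^ (k + 4 + n) ≤ (1 / 2) ^ (k + 3) := by
    have hn : (n : ℝ) ≤ 2 ^ n := by exact_mod_cast Nat.lt_two_pow_self.le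
    rw [one_div_pow, div_le_div_iff₀ (by positivity) (by positivity), pow_add _ (k + 4) n,
      show (2 : ℝ) ^ (k + 4) = 2 * 2 ^ (k + 3) by ring]
    nlinarith [pow_pos (two_pos (α := ℝ)) (k + 3)]
  -- `parityAt c s` is `stepFun s (scanCell c s)` by definition, so it links the two estimates.
  calc _ ≤ ∫ x in halfCube n, (|parityLimit c x - parityAt c (s k) x| +
        |stepFun (s k) (scanCell c (s k)) x -
          smoothStep (s k) (2 ^ (k + 4 + n)) (scanCell c (s k)) x|) :=
        setIntegral_mono (hpi.sub hhi).abs ((hpi.sub hsi).abs.add (hsi.sub hhi).abs)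
          fun x => abs_sub_le _ _ _
    _ = _ := integral_add (hpi.sub hsi).abs (hsi.sub hhi).abs
    _ ≤ (1 / 2) ^ (k + 2) + (1 / 2) ^ (k + 3) := add_le_add h1 (h2.trans h3)
    _ < (1 / 2) ^ k := by
        have : (0 : ℝ) < (1 / 2) ^ k := by positivity
        rw [pow_add, pow_add]
        linarith

/-! ### Oscillation of the averages at a point captured by the test -/

/-- The index of a cell of `[0,1]^n` whose closure contains `z`. -/
noncomputable def closedIndex (N : ℕ) (z : Fin n → ℝ) : Fin n → ℕ := fun i =>
  -- A coordinate equal to `1` has index `2^N`, outside the cube; the last cell is used instead.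
  min (cellIndex N z i) (2 ^ N - 1)

theorem closedIndex_lt (N : ℕ) (z : Fin n → ℝ) (i : Fin n) : closedIndex N z i < 2 ^ N :=
  (min_le_right _ _).trans_lt (Nat.sub_lt (by positivity) one_pos)

theorem closedIndex_bounds (N : ℕ) {z : Fin n → ℝ} (hz : z ∈ unitCube n) (i : Fin n) :
    (closedIndex N z i : ℝ) ≤ z i * 2 ^ N ∧ z i * 2 ^ N ≤ closedIndex N z i + 1 := by
  obtain ⟨h1, h2⟩ := cell_index_bounds (N := N) hz i
  refine ⟨(Nat.cast_le.2 (min_le_left _ _)).trans h1, ?_⟩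
  rw [closedIndex]
  rcases le_total (cellIndex N z i) (2 ^ N - 1) with h | h
  · rw [min_eq_left h]
    exact h2.le
  · rw [min_eq_right h, Nat.cast_sub Nat.one_le_two_pow]
    push_cast
    rw [sub_add_cancel]
    exact mul_le_of_le_one_left (by positivity) (mem_unitCube.1 hz i).2

/-- Dropping binary digits is monotone, hence commutes with `min`, and sends `2^S - 1` to `2^N - 1`.
So the chosen cells are nested. -/
theorem closedIndex_coarsen {N S : ℕ} (h : N ≤ S) (z : Fin n → ℝ) :
    closedIndex N z = fun i => closedIndex S z i / 2 ^ (S - N) := by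
  funext i
  have hmono : Monotone fun a : ℕ => a / 2 ^ (S - N) := fun _ _ hab => Nat.div_le_div_right hab
  have h1 : (2 ^ S - 1) / 2 ^ (S - N) = 2 ^ N - 1 := by
    have hS : 2 ^ S = 2 ^ N * 2 ^ (S - N) := by rw [← pow_add, Nat.add_sub_cancel' h]
    have hpos : 0 < 2 ^ (S - N) := by positivity
    have hN : 0 < 2 ^ N := by positivity
    rw [Nat.div_eq_iff hpos, hS, Nat.sub_mul, one_mul]
    have : 2 ^ (S - N) ≤ 2 ^ N * 2 ^ (S - N) := Nat.le_mul_of_pos_left _ hN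
    omega
  have h2 := hmono.map_min (a := cellIndex S z i) (b := 2 ^ S - 1)
  rw [closedIndex, closedIndex, h2, h1, cellIndex_coarsen h]

/-- A frozen state would keep waiting for one fixed member of the test; but `z` lies in it, so fine
cells around `z` are covered. -/
theorem exists_mark {c : ℕ → ℕ → CubeCode n} {z : Fin n → ℝ} (hzc : z ∈ unitCube n)
    (hz : ∀ m, z ∈ ⋃ i, openCube (c m i)) (s : ℕ) : ∃ N > s,
      scan c (fun j => closedIndex j z) N =
        (!(scan c (fun j => closedIndex j z) s).1, N) := by
  rcases scan_const_or_marks c (fun j => closedIndex j z) s with h | ⟨j, hj, heq, hcov⟩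
  · exfalso
    obtain ⟨N, hN⟩ := exists_covered
      (hz ((n + 1) * (scan c (fun j => closedIndex j z) s).2 + 2))
    have h1 := hN (max N (s + 1)) (le_max_left _ _) _ fun i => closedIndex_bounds _ hzc i
    have h2 := h (max N (s + 1)) (by omega)
    have h3 := scan_snd_le c (fun j => closedIndex j z) s
    have h4 := not_covered_of_scan (c := c) (u := fun j => closedIndex j z)
      (j := max N (s + 1)) (by rw [h2]; omega)
    rw [h2] at h4
    simp [h1] at h4
  · exact ⟨j + 1, by omega, by rw [scan, heq, if_pos hcov]⟩

theorem cell_ae_eq (N : ℕ) (v : Fin n → ℕ) : cell N v =ᵐ[volume]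
    Icc (fun i => (v i : ℝ) / 2 ^ N) fun i => (v i : ℝ) / 2 ^ N + 1 / 2 ^ N := by
  have h := Measure.univ_pi_Ico_ae_eq_Icc (μ := fun _ : Fin n => (volume : Measure ℝ))
    (f := fun i => (v i : ℝ) / 2 ^ N) (g := fun i => (v i : ℝ) / 2 ^ N + 1 / 2 ^ N)
  rw [← volume_pi] at h
  simpa only [cell, add_div] using h

/-- In a cell marked at level `N`, any later mark happens inside member `(n + 1) * N + 2`, of
measure at most a quarter of the cell. Elsewhere in the cell the parity is final. -/
theorem abs_average_sub_le {c : ℕ → ℕ → CubeCode n}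
    (hle : ∀ m, volume.real (testSet c m) ≤ (1 / 2) ^ m) {z : Fin n → ℝ} {N : ℕ}
    (hN : (scan c (fun j => closedIndex j z) N).2 = N) :
    |(((1 / 2 : ℝ) ^ N) ^ n)⁻¹ * (∫ x in Icc (fun i => (closedIndex N z i : ℝ) / 2 ^ N)
      fun i => (closedIndex N z i : ℝ) / 2 ^ N + 1 / 2 ^ N, parityLimit c x) -
      (if (scan c (fun j => closedIndex j z) N).1 = true then 1 else 0)| ≤ 1 / 4 := by
  set β : ℝ := if (scan c (fun j => closedIndex j z) N).1 = true then 1 else 0 with hβ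
  have hscan : scan c (fun j => closedIndex j z) N =
      scan c (fun j i => closedIndex N z i / 2 ^ (N - j)) N :=
    scan_congr fun j hj => closedIndex_coarsen hj z
  have hsub := cell_subset_halfCube (closedIndex_lt N z)
  have hidx : ∀ x ∈ cell N (closedIndex N z), cellIndex N x = closedIndex N z := fun x hx =>
    (mem_cell_iff fun i => (mem_halfCube.1 (hsub hx) i).1).1 hx
  have hpt : ∀ x ∈ cell N (closedIndex N z), |parityLimit c x - β| ≤
      (testSet c ((n + 1) * N + 2)).indicator (fun _ => (1 : ℝ)) x := by
    intro x hx
    have hat : parityAt c N x = β := by rw [parityAt, hidx x hx, scanCell, ← hscan]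
    rcases parityLimit_eq_or c N x with h | ⟨j, -, hj⟩
    · rw [h, hat, sub_self, abs_zero]
      exact indicator_nonneg (fun _ _ => zero_le_one) _
    · rw [scan_cellIndex, hidx x hx, ← hscan, hN] at hj
      rw [indicator_of_mem (mem_testSet_of_covered (hsub hx) hj), abs_le]
      have h1 := parityLimit_nonneg c x
      have h2 := parityLimit_le_one c x
      have h3 : 0 ≤ β ∧ β ≤ 1 := by
        rw [hβ]
        split_ifs <;> norm_num
      constructor <;> linarith
  have hfin : volume (cell N (closedIndex N z)) ≠ ⊤ := volume_cell_ne_top _ _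
  have hpi := (integrableOn_parityLimit c).mono_set (hsub.trans halfCube_subset_unitCube)
  have hv : volume.real (cell N (closedIndex N z)) = ((1 / 2) ^ N) ^ n := by
    rw [volume_real_cell, one_div_pow, one_div_pow]
  have hpos : (0 : ℝ) < ((1 / 2) ^ N) ^ n := by positivity
  rw [← setIntegral_congr_set (cell_ae_eq N _)]
  have hint : |(∫ x in cell N (closedIndex N z), parityLimit c x) - ((1 / 2) ^ N) ^ n * β| ≤
      ((1 / 2) ^ N) ^ n * (1 / 4) := by
    calc _ = |∫ x in cell N (closedIndex N z), (parityLimit c x - β)| := by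
          rw [integral_sub hpi (integrableOn_const hfin), setIntegral_const, hv, smul_eq_mul]
      _ ≤ ∫ x in cell N (closedIndex N z), |parityLimit c x - β| := abs_integral_le_integral_abs
      _ ≤ ∫ x in cell N (closedIndex N z),
            (testSet c ((n + 1) * N + 2)).indicator (fun _ => (1 : ℝ)) x :=
          setIntegral_mono_on (hpi.sub (integrableOn_const hfin)).abs
            ((integrableOn_const hfin).indicator (measurableSet_testSet c _))
            (measurableSet_cell _ _) hpt
      _ = volume.real (cell N (closedIndex N z) ∩ testSet c ((n + 1) * N + 2)) := by
          rw [setIntegral_indicator (measurableSet_testSet c _), setIntegral_one_eq_measureReal]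
      _ ≤ volume.real (testSet c ((n + 1) * N + 2)) :=
          measureReal_mono inter_subset_right
            (volume_ne_top_of_subset (testSet_subset_unitCube c _))
      _ ≤ (1 / 2) ^ ((n + 1) * N + 2) := hle _
      _ ≤ (1 / 2) ^ (N * n + 2) :=
          pow_le_pow_of_le_one (by norm_num) (by norm_num) (by nlinarith)
      _ = _ := by rw [pow_add, pow_mul]; norm_num
  have heq : (((1 / 2 : ℝ) ^ N) ^ n)⁻¹ * (∫ x in cell N (closedIndex N z), parityLimit c x) - β =
      (((1 / 2 : ℝ) ^ N) ^ n)⁻¹ *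
        ((∫ x in cell N (closedIndex N z), parityLimit c x) - ((1 / 2) ^ N) ^ n * β) := by
    rw [mul_sub, inv_mul_cancel_left₀ hpos.ne']
  rw [heq, abs_mul, abs_of_pos (inv_pos.2 hpos), inv_mul_le_iff₀ hpos]
  exact hint

theorem not_isWeakLebesguePoint_parityLimit (hn : n ≠ 0) {c : ℕ → ℕ → CubeCode n}
    (hle : ∀ m, volume.real (testSet c m) ≤ (1 / 2) ^ m) {z : Fin n → ℝ} (hzc : z ∈ unitCube n)
    (hz : ∀ m, z ∈ ⋃ i, openCube (c m i)) : ¬ IsWeakLebesguePoint (parityLimit c) z := by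
  rintro ⟨L, hL⟩
  obtain ⟨δ, hδ, hL⟩ := hL (1 / 8) (by norm_num)
  obtain ⟨M, hM⟩ := exists_pow_lt_of_lt_one hδ (by norm_num : (1 / 2 : ℝ) < 1)
  have key : ∀ N ≥ M, (scan c (fun j => closedIndex j z) N).2 = N →
      |L - (if (scan c (fun j => closedIndex j z) N).1 = true then 1 else 0)| < 1 / 2 := by
    intro N hNM hN
    have hp := pow_pos (two_pos (α := ℝ)) N
    have h1 := abs_average_sub_le hle hN
    have hvol := volume_real_cube (fun i => (closedIndex N z i : ℝ) / 2 ^ N)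
      (by positivity : (0 : ℝ) < 1 / 2 ^ N)
    rw [← one_div_pow] at hvol
    have h2 := hL (Icc (fun i => (closedIndex N z i : ℝ) / 2 ^ N)
      fun i => (closedIndex N z i : ℝ) / 2 ^ N + 1 / 2 ^ N) ⟨fun x hx => mem_unitCube.2 fun i => ?_,
        _, _, by positivity, rfl⟩ ⟨fun i => ?_, fun i => ?_⟩ ?_
    · rw [← one_div_pow, hvol] at h2
      rw [← one_div_pow] at h1
      rw [abs_le] at h1
      rw [abs_lt] at h2 ⊢
      constructor <;> linarith [h1.1, h1.2, h2.1, h2.2]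
    · have h3 : (closedIndex N z i : ℝ) / 2 ^ N ≤ x i := hx.1 i
      have h4 : x i ≤ (closedIndex N z i : ℝ) / 2 ^ N + 1 / 2 ^ N := hx.2 i
      have h5 : (closedIndex N z i : ℝ) + 1 ≤ 2 ^ N := by exact_mod_cast closedIndex_lt N z i
      refine ⟨(by positivity : (0 : ℝ) ≤ (closedIndex N z i : ℝ) / 2 ^ N).trans h3, h4.trans ?_⟩
      rwa [← add_div, div_le_one hp]
    · exact (div_le_iff₀ hp).2 (closedIndex_bounds N hzc i).1
    · dsimp only
      rw [← add_div]
      exact (le_div_iff₀ hp).2 (closedIndex_bounds N hzc i).2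
    · rw [← one_div_pow, hvol]
      refine lt_of_le_of_lt ?_ hM
      rw [← pow_mul]
      exact pow_le_pow_of_le_one (by norm_num) (by norm_num)
        (hNM.trans (Nat.le_mul_of_pos_right _ (Nat.pos_of_ne_zero hn)))
  -- Two successive marks have opposite parities, yet `L` would be within `1/8 + 1/4 < 1/2` of both.
  obtain ⟨N, hN, h1⟩ := exists_mark hzc hz M
  obtain ⟨N', hN', h2⟩ := exists_mark hzc hz N
  have h3 := key N hN.le (by rw [h1])
  have h4 := key N' (hN.le.trans hN'.le) (by rw [h2])
  rw [h2] at h4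
  rw [abs_lt] at h3 h4
  cases hb : (scan c (fun j => closedIndex j z) N).1 <;> simp [hb] at h3 h4 <;> linarith

/-- The cube is one point of measure `1`, too much for member `1` of a test. This case is separate
because volumes of cubes do not shrink. -/
theorem isSchnorrRandom_of_dim_eq_zero (hn : n = 0) {z : Fin n → ℝ} (hz : z ∈ unitCube n) :
    IsSchnorrRandom z := by
  subst hn
  intro G hG hzG
  have h := hG.measure_le 1
  have hG1 : G 1 = unitCube 0 := by
    rw [Subsingleton.eq_univ_of_nonempty ⟨z, mem_iInter.1 hzG 1⟩,
      Subsingleton.eq_univ_of_nonempty ⟨z, hz⟩]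
  rw [hG1, measureReal_def, volume_unitCube] at h
  norm_num at h

theorem isSchnorrRandom_of_isWeakLebesguePoint {z : Fin n → ℝ} (hzc : z ∈ unitCube n)
    (h : ∀ g : (Fin n → ℝ) → ℝ, IsL1Computable g → (∃ C : ℝ, ∀ x ∈ unitCube n, |g x| ≤ C) →
      IsWeakLebesguePoint g z) : IsSchnorrRandom z := by
  by_cases hn : n = 0
  · exact isSchnorrRandom_of_dim_eq_zero hn hzc
  intro G hG hzG
  obtain ⟨c, hc, hGc⟩ := hG.sigmaOne
  have hvol : ∀ m, volume.real (testSet c m) = volume.real (G m) := fun m => by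
    rw [hGc]
    exact measureReal_congr (testSet_ae_eq c m)
  have hle : ∀ m, volume.real (testSet c m) ≤ (1 / 2) ^ m := fun m =>
    (hvol m).trans_le (hG.measure_le m)
  have hm := hG.measure_computable
  simp only [← hvol] at hm
  -- Passing to `testSet` loses a null set that may contain `z`; membership of `z` is therefore used
  -- only in the open cubes.
  refine not_isWeakLebesguePoint_parityLimit hn hle hzc (fun m => ?_)
    (h _ (isL1Computable_parityLimit hc hle hm) ⟨1, fun x _ => ?_⟩)
  · have := mem_iInter.1 hzG m
    rw [hGc] at this
    exact this.2
  · rw [abs_of_nonneg (parityLimit_nonneg c x)]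
    exact parityLimit_le_one c x

end Schnorr

theorem theorem5p1 (n : ℕ) (z : Fin n → ℝ) (hz : z ∈ Schnorr.unitCube n) :
    Schnorr.IsSchnorrRandom z ↔
      ∀ g : (Fin n → ℝ) → ℝ, Schnorr.IsL1Computable g →
        (∃ C : ℝ, ∀ x ∈ Schnorr.unitCube n, |g x| ≤ C) →
        Schnorr.IsWeakLebesguePoint g z :=
  ⟨fun h _ hg _ => h.isWeakLebesguePoint hz hg,
    Schnorr.isSchnorrRandom_of_isWeakLebesguePoint hz⟩
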